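/- Let $n\ge 0$ be an integer. There is a constant $C_n>0$ depending only on $n$ with the following property. Let $M$ be a compact smooth $n$-dimensional manifold without boundary, let $T>0$, and let $g(t)$, $A(t)$, $B(t)$, $t\in[0,T]$, be a Riemannian metric, a $1$-form and a $2$-form on $M$, smooth on $M\times[0,T]$. Put $F=dA$ and $H=dB$, and let $R_{ij}$ and ${\rm Rm}$ denote the Ricci and Riemann curvature tensors of $g(t)$ (with $R_{ij}$ positive on round spheres). Suppose that $(g,H,F)$ solves the generalized Ricci flow on $M\times[0,T]$, that is, in all local coordinates $$\frac{\partial}{\partial t}g_{ij}=-2R_{ij}+\frac12 H_{ikl}H_j{}^{kl}+2F_i{}^kF_{jk},\qquad \frac{\partial}{\partial t}A_i=-\nabla_kF_i{}^k,\qquad \frac{\partial}{\partial t}B_{ij}=\nabla_kH^k{}_{ij},$$ where indices are raised with $g(t)$ and $\nabla$ is the Levi-Civita connection of $g(t)$. For tensors put $|S|_g^2=g^{i_1j_1}\cdots g^{i_pj_p}S_{i_1\cdots i_p}S_{j_1\cdots j_p}$. If $K_1,K_2,K_3\ge 0$ are such that $$|{\rm Rm}(x,t)|_{g(x,t)}\le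 K_1,\qquad |H(x,0)|_{g(x,0)}\le K_2,\qquad |F(x,0)|_{g(x,0)}\le K_3$$ for all $x\in M$ and $t\in[0,T]$, then $$|H(x,t)|_{g(x,t)}\le K_2e^{C_nK_1t},\qquad |F(x,t)|_{g(x,t)}\le K_3e^{C_nK_1t}$$ for all $x\in M$ and $t\in[0,T]$. -/

import Mathlib

open Set
open scoped Manifold ContDiff

noncomputable section

namespace GRF

/-! ### Tensor calculus on an open subset of `ℝⁿ`

`G y` is the matrix `(g_{ij}(y))` of a Riemannian metric in coordinates, `(G y)⁻¹` is `(g^{ij}(y))`.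
Tensor fields are given by their component functions. -/

/-- The partial derivative `∂_i f (y)`. -/
def pderiv {n : ℕ} (i : Fin n) (f : EuclideanSpace ℝ (Fin n) → ℝ)
    (y : EuclideanSpace ℝ (Fin n)) : ℝ :=
  fderiv ℝ f y (EuclideanSpace.single i 1)

/-- `Γ^k_{ij} = ½ g^{kl} (∂_i g_{jl} + ∂_j g_{il} - ∂_l g_{ij})`. -/
def christoffel {n : ℕ} (G : EuclideanSpace ℝ (Fin n) → Matrix (Fin n) (Fin n) ℝ)
    (k i j : Fin n) (y : EuclideanSpace ℝ (Fin n)) : ℝ :=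
  (1 / 2) * ∑ l, (G y)⁻¹ k l *
    (pderiv i (fun z => G z j l) y + pderiv j (fun z => G z i l) y - pderiv l (fun z => G z i j) y)

/-- The Riemann tensor with all indices lowered, `R_{ijkl} = g(R(∂_i, ∂_j) ∂_l, ∂_k)`, where
`R(X, Y) = ∇_X ∇_Y - ∇_Y ∇_X - ∇_{[X, Y]}`; thus `R_{ijij} > 0` on round spheres. -/
def riemann {n : ℕ} (G : EuclideanSpace ℝ (Fin n) → Matrix (Fin n) (Fin n) ℝ)
    (i j k l : Fin n) (y : EuclideanSpace ℝ (Fin n)) : ℝ :=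
  ∑ p, G y k p *
    (pderiv i (christoffel G p j l) y - pderiv j (christoffel G p i l) y
      + ∑ q, (christoffel G p i q y * christoffel G q j l y
        - christoffel G p j q y * christoffel G q i l y))

/-- The Ricci tensor `R_{ij} = g^{kl} R_{ikjl}`. -/
def ricci {n : ℕ} (G : EuclideanSpace ℝ (Fin n) → Matrix (Fin n) (Fin n) ℝ)
    (i j : Fin n) (y : EuclideanSpace ℝ (Fin n)) : ℝ :=
  ∑ k, ∑ l, (G y)⁻¹ k l * riemann G i k j l y

/-- The covariant derivative `∇_m S_{ij}` of a covariant 2-tensor. -/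
def covDeriv₂ {n : ℕ} (G : EuclideanSpace ℝ (Fin n) → Matrix (Fin n) (Fin n) ℝ)
    (S : Fin n → Fin n → EuclideanSpace ℝ (Fin n) → ℝ)
    (m i j : Fin n) (y : EuclideanSpace ℝ (Fin n)) : ℝ :=
  pderiv m (S i j) y - ∑ p, christoffel G p m i y * S p j y - ∑ p, christoffel G p m j y * S i p y

/-- The covariant derivative `∇_m S_{ijk}` of a covariant 3-tensor. -/
def covDeriv₃ {n : ℕ} (G : EuclideanSpace ℝ (Fin n) → Matrix (Fin n) (Fin n) ℝ)
    (S : Fin n → Fin n → Fin n → EuclideanSpace ℝ (Fin n) → ℝ)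
    (m i j k : Fin n) (y : EuclideanSpace ℝ (Fin n)) : ℝ :=
  pderiv m (S i j k) y - ∑ p, christoffel G p m i y * S p j k y
    - ∑ p, christoffel G p m j y * S i p k y - ∑ p, christoffel G p m k y * S i j p y

/-- `g^{ia} g^{jb} S_{ij} S_{ab}`, where `g` is the inverse-metric matrix. -/
def normSq₂ {n : ℕ} (g : Matrix (Fin n) (Fin n) ℝ) (S : Fin n → Fin n → ℝ) : ℝ :=
  ∑ i, ∑ j, ∑ a, ∑ b, g i a * g j b * S i j * S a b

/-- `g^{ia} g^{jb} g^{kc} S_{ijk} S_{abc}`, where `g` is the inverse-metric matrix. -/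
def normSq₃ {n : ℕ} (g : Matrix (Fin n) (Fin n) ℝ) (S : Fin n → Fin n → Fin n → ℝ) : ℝ :=
  ∑ i, ∑ j, ∑ k, ∑ a, ∑ b, ∑ c, g i a * g j b * g k c * S i j k * S a b c

/-- `g^{ia} g^{jb} g^{kc} g^{ld} S_{ijkl} S_{abcd}`, where `g` is the inverse-metric matrix. -/
def normSq₄ {n : ℕ} (g : Matrix (Fin n) (Fin n) ℝ) (S : Fin n → Fin n → Fin n → Fin n → ℝ) : ℝ :=
  ∑ i, ∑ j, ∑ k, ∑ l, ∑ a, ∑ b, ∑ c, ∑ d,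
    g i a * g j b * g k c * g l d * S i j k l * S a b c d

/-! ### Metrics and differential forms on a manifold, read in charts -/

/-- Smooth Riemannian metrics on the `n`-manifold `M`. -/
abbrev Metric (n : ℕ) (M : Type*) [TopologicalSpace M] [ChartedSpace (EuclideanSpace ℝ (Fin n)) M]
    [IsManifold (𝓡 n) ∞ M] :=
  Bundle.ContMDiffRiemannianMetric (𝓡 n) ∞ (EuclideanSpace ℝ (Fin n))
    (fun x : M => TangentSpace (𝓡 n) x)

/-- Fields of alternating `p`-linear forms on the tangent spaces of `M`. -/
abbrev Form (n : ℕ) (M : Type*) [TopologicalSpace M] [ChartedSpace (EuclideanSpace ℝ (Fin n)) M]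
    (p : ℕ) :=
  ∀ x : M, (TangentSpace (𝓡 n) x) [⋀^Fin p]→L[ℝ] ℝ

section Charts

variable {n : ℕ} {M : Type*} [TopologicalSpace M] [ChartedSpace (EuclideanSpace ℝ (Fin n)) M]

/-- The differential at `y` of the inverse of the chart `e`; it maps the `i`-th standard basis
vector to the coordinate vector field `∂_i` of `e` at the point with coordinates `y`. -/
def chartDeriv (e : OpenPartialHomeomorph M (EuclideanSpace ℝ (Fin n)))
    (y : EuclideanSpace ℝ (Fin n)) :
    EuclideanSpace ℝ (Fin n) →L[ℝ] TangentSpace (𝓡 n) (e.symm y) :=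
  mfderiv (𝓡 n) (𝓡 n) e.symm y

/-- The metric in the chart `e`: `y ↦ (g(∂_i, ∂_j))_{ij}`. -/
def metricIn [IsManifold (𝓡 n) ∞ M] (e : OpenPartialHomeomorph M (EuclideanSpace ℝ (Fin n)))
    (g : Metric n M) (y : EuclideanSpace ℝ (Fin n)) : Matrix (Fin n) (Fin n) ℝ :=
  Matrix.of fun i j => g.inner (e.symm y) (chartDeriv e y (EuclideanSpace.single i 1))
    (chartDeriv e y (EuclideanSpace.single j 1))

/-- The form `α` in the chart `e`: its pullback under the inverse of `e`. -/
def formIn {p : ℕ} (e : OpenPartialHomeomorph M (EuclideanSpace ℝ (Fin n))) (α : Form n M p)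
    (y : EuclideanSpace ℝ (Fin n)) : (EuclideanSpace ℝ (Fin n)) [⋀^Fin p]→L[ℝ] ℝ :=
  (α (e.symm y)).compContinuousLinearMap (chartDeriv e y)

/-- The components `α_i` of a 1-form in the chart `e`. -/
def comp₁ (e : OpenPartialHomeomorph M (EuclideanSpace ℝ (Fin n))) (α : Form n M 1)
    (i : Fin n) (y : EuclideanSpace ℝ (Fin n)) : ℝ :=
  formIn e α y ![EuclideanSpace.single i 1]

/-- The components `α_{ij}` of a 2-form in the chart `e`. -/
def comp₂ (e : OpenPartialHomeomorph M (EuclideanSpace ℝ (Fin n))) (α : Form n M 2)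
    (i j : Fin n) (y : EuclideanSpace ℝ (Fin n)) : ℝ :=
  formIn e α y ![EuclideanSpace.single i 1, EuclideanSpace.single j 1]

/-- The components `α_{ijk}` of a 3-form in the chart `e`. -/
def comp₃ (e : OpenPartialHomeomorph M (EuclideanSpace ℝ (Fin n))) (α : Form n M 3)
    (i j k : Fin n) (y : EuclideanSpace ℝ (Fin n)) : ℝ :=
  formIn e α y
    ![EuclideanSpace.single i 1, EuclideanSpace.single j 1, EuclideanSpace.single k 1]

/-- `η = dα`: the identity holds in all smooth charts of `M`. -/
def IsExtDeriv {p : ℕ} (η : Form n M (p + 1)) (α : Form n M p) : Prop :=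
  ∀ e ∈ IsManifold.maximalAtlas (𝓡 n) ∞ M, ∀ y ∈ e.target,
    formIn e η y = extDeriv (formIn e α) y

/-- A time-dependent form is smooth on `M × [0, T]`. -/
def SmoothFormOn {p : ℕ} (T : ℝ) (α : ℝ → Form n M p) : Prop :=
  ∀ e ∈ IsManifold.maximalAtlas (𝓡 n) ∞ M,
    ContDiffOn ℝ ∞ (fun z : EuclideanSpace ℝ (Fin n) × ℝ => formIn e (α z.2) z.1)
      (e.target ×ˢ Icc 0 T)

variable [IsManifold (𝓡 n) ∞ M]

/-- A time-dependent metric is smooth on `M × [0, T]`. -/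
def SmoothMetricOn (T : ℝ) (g : ℝ → Metric n M) : Prop :=
  ∀ e ∈ IsManifold.maximalAtlas (𝓡 n) ∞ M, ∀ i j : Fin n,
    ContDiffOn ℝ ∞ (fun z : EuclideanSpace ℝ (Fin n) × ℝ => metricIn e (g z.2) z.1 i j)
      (e.target ×ˢ Icc 0 T)

/-- The norm `|Rm|_g` at the point `x`, computed in a smooth chart `e` around `x`;
by tensoriality it does not depend on the choice of `e`. -/
def rmNorm (g : Metric n M) (e : OpenPartialHomeomorph M (EuclideanSpace ℝ (Fin n))) (x : M) : ℝ :=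
  √(normSq₄ (metricIn e g (e x))⁻¹ fun i j k l => riemann (metricIn e g) i j k l (e x))

/-- The tensor norm `|F|_g` of a 2-form at `x`, computed in a smooth chart `e` around `x`;
by tensoriality it does not depend on the choice of `e`. -/
def norm₂ (g : Metric n M) (e : OpenPartialHomeomorph M (EuclideanSpace ℝ (Fin n)))
    (F : Form n M 2) (x : M) : ℝ :=
  √(normSq₂ (metricIn e g (e x))⁻¹ fun i j => comp₂ e F i j (e x))

/-- The tensor norm `|H|_g` of a 3-form at `x`, computed in a smooth chart `e` around `x`;
by tensoriality it does not depend on the choice of `e`. -/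
def norm₃ (g : Metric n M) (e : OpenPartialHomeomorph M (EuclideanSpace ℝ (Fin n)))
    (H : Form n M 3) (x : M) : ℝ :=
  √(normSq₃ (metricIn e g (e x))⁻¹ fun i j k => comp₃ e H i j k (e x))

/-- `h_{ij} = H_{ikl} H_j{}^{kl}` in the chart `e`. -/
def hTensor (g : Metric n M) (e : OpenPartialHomeomorph M (EuclideanSpace ℝ (Fin n)))
    (H : Form n M 3) (i j : Fin n) (y : EuclideanSpace ℝ (Fin n)) : ℝ :=
  ∑ k, ∑ l, ∑ p, ∑ q, (metricIn e g y)⁻¹ k p * (metricIn e g y)⁻¹ l q *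
    comp₃ e H i k l y * comp₃ e H j p q y

/-- `f_{ij} = F_i{}^k F_{jk}` in the chart `e`. -/
def fTensor (g : Metric n M) (e : OpenPartialHomeomorph M (EuclideanSpace ℝ (Fin n)))
    (F : Form n M 2) (i j : Fin n) (y : EuclideanSpace ℝ (Fin n)) : ℝ :=
  ∑ k, ∑ p, (metricIn e g y)⁻¹ k p * comp₂ e F i p y * comp₂ e F j k y

/-- `(g, H, F)` is a smooth solution on `M × [0, T]` of the generalized Ricci flow with potentials
`A` (a 1-form) and `B` (a 2-form): `F = dA`, `H = dB` and, in all smooth charts,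
`∂_t g_{ij} = -2 R_{ij} + ½ h_{ij} + 2 f_{ij}`, `∂_t A_i = -∇_k F_i{}^k`,
`∂_t B_{ij} = ∇_k H^k{}_{ij}` (time derivatives are one-sided at `t = 0` and `t = T`). -/
structure IsSolution (T : ℝ) (g : ℝ → Metric n M) (A : ℝ → Form n M 1) (B : ℝ → Form n M 2)
    (F : ℝ → Form n M 2) (H : ℝ → Form n M 3) : Prop where
  smooth_g : SmoothMetricOn T g
  smooth_A : SmoothFormOn T A
  smooth_B : SmoothFormOn T B
  F_eq : ∀ t ∈ Icc 0 T, IsExtDeriv (F t) (A t)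
  H_eq : ∀ t ∈ Icc 0 T, IsExtDeriv (H t) (B t)
  flow_g : ∀ e ∈ IsManifold.maximalAtlas (𝓡 n) ∞ M, ∀ y ∈ e.target, ∀ t ∈ Icc 0 T,
    ∀ i j : Fin n,
      HasDerivWithinAt (fun s => metricIn e (g s) y i j)
        (-2 * ricci (metricIn e (g t)) i j y + (1 / 2) * hTensor (g t) e (H t) i j y
          + 2 * fTensor (g t) e (F t) i j y) (Icc 0 T) t
  flow_A : ∀ e ∈ IsManifold.maximalAtlas (𝓡 n) ∞ M, ∀ y ∈ e.target, ∀ t ∈ Icc 0 T,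
    ∀ i : Fin n,
      HasDerivWithinAt (fun s => comp₁ e (A s) i y)
        (-∑ k, ∑ l, (metricIn e (g t) y)⁻¹ k l *
          covDeriv₂ (metricIn e (g t)) (comp₂ e (F t)) k i l y) (Icc 0 T) t
  flow_B : ∀ e ∈ IsManifold.maximalAtlas (𝓡 n) ∞ M, ∀ y ∈ e.target, ∀ t ∈ Icc 0 T,
    ∀ i j : Fin n,
      HasDerivWithinAt (fun s => comp₂ e (B s) i j y)
        (∑ k, ∑ l, (metricIn e (g t) y)⁻¹ k l *
          covDeriv₃ (metricIn e (g t)) (comp₃ e (H t)) k l i j y) (Icc 0 T) t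

end Charts

end GRF

end

/-! Both bounds come from the parabolic maximum principle applied to `u = |F|²` and `u = |H|²`.
Where `u(·, t)` attains its spatial maximum, `∂_t u ≤ 6 K₁ u`; hence `u ≤ u_max(0) e^{6 K₁ t}`
(`le_exp_mul_of_deriv_le_at_max`), and a square root halves the exponent, so the constant 3 works in
every dimension.

For the inequality, take at the maximum a chart in which `g(t)` is the identity to first order
(`exists_isNormalAt`). There the sum of the pure second coordinate derivatives of `u` is
nonpositive, so no Laplacian has to be defined, and everything becomes algebra in the 2-jets of the
metric and the form. Three mechanisms settle the signs.

(1) `∂_t F = d(∂_t A)` and `∂_t H = d(∂_t B)`, where the right sides are exterior derivatives of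
divergences. Contracting with the form and using that it is closed turns the second derivatives into
the form paired with its rough Laplacian. These match the second derivatives of `u` up to the
squared gradient, which has the favourable sign.

(2) The Ricci part of `∂_t g⁻¹`, the second derivatives of `g⁻¹` in the Hessian of `u`, and the
traced Christoffel derivatives cancel exactly (`ricci_terms_cancel`). What remains is the full
curvature tensor contracted with two copies of the form, which Cauchy-Schwarz bounds
(`abs_sum_riemann_mul_le`).

(3) The quadratic terms `½ h + 2 f` of the metric flow enter `∂_t u` with a minus sign, paired with
the Gram matrix of the form itself. Both factors are positive semidefinite, so this term can be
dropped (`sum_reaction_nonneg`). This is why no bound on `H` or `F` at later times is needed.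

The algebra is in `evolution_inequality₂` and `evolution_inequality₃`. Chart independence of the
norms (`normSq₂_chart_eq`, `normSq₃_chart_eq`) makes `u` a function on `M` and allows the chart to
be chosen freely at each maximum. -/

noncomputable section

namespace GRF

open Filter Topology

/-! ### The parabolic maximum principle -/

/-- Parabolic maximum principle on a compact space, for a function whose time derivative at
spatial maxima is at most `c * u`. -/
theorem le_exp_mul_of_deriv_le_at_max {X : Type*} [TopologicalSpace X] [CompactSpace X]
    {u : X → ℝ → ℝ} {T c K : ℝ} (hT : 0 < T)
    (hu : ContinuousOn (fun z : X × ℝ => u z.1 z.2) (univ ×ˢ Icc 0 T))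
    (hmax : ∀ x₀, ∀ t₀ ∈ Ioo 0 T, (∀ x, u x t₀ ≤ u x₀ t₀) →
      ∃ d, HasDerivAt (u x₀) d t₀ ∧ d ≤ c * u x₀ t₀)
    (h₀ : ∀ x, u x 0 ≤ K) {t : ℝ} (ht : t ∈ Icc 0 T) (x : X) :
    u x t ≤ K * Real.exp (c * t) := by
  -- Stopping at `S < T` keeps every positive maximum time inside `(0, T)`, where two-sided time
  -- derivatives exist. The term `ε * t` makes the derivative at such a maximum strictly negative;
  -- `ε` is sent to zero afterwards, and the times 0 and `T` are reached by continuity.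
  have key : ∀ S ∈ Ioo 0 T, ∀ ε > 0, ∀ x,
      Real.exp (-c * S) * u x S - ε * S ≤ K := by
    intro S hS ε hε x
    set φ : X × ℝ → ℝ := fun z => Real.exp (-c * z.2) * u z.1 z.2 - ε * z.2 with hφ
    have hφc : ContinuousOn φ (univ ×ˢ Icc 0 S) := by
      refine ContinuousOn.sub (ContinuousOn.mul (by fun_prop) (hu.mono ?_)) (by fun_prop)
      exact prod_mono le_rfl (Icc_subset_Icc le_rfl hS.2.le)
    obtain ⟨⟨x₀, t₀⟩, hz, hm⟩ := (isCompact_univ.prod (isCompact_Icc (a := (0 : ℝ)) (b := S)))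
      |>.exists_isMaxOn ⟨(x, S), ⟨mem_univ _, hS.1.le, le_rfl⟩⟩ hφc
    have hm' : ∀ x', ∀ t' ∈ Icc 0 S, φ (x', t') ≤ φ (x₀, t₀) :=
      fun x' t' h' => hm ⟨mem_univ _, h'⟩
    have ht₀ : t₀ ∈ Icc 0 S := hz.2
    rcases ht₀.1.eq_or_lt with h | hpos
    · subst h
      have := hm' x S ⟨hS.1.le, le_rfl⟩
      simp only [hφ] at this
      have h1 := h₀ x₀
      simp at this
      simp only [neg_mul]
      linarith
    exfalso
    have hsp : ∀ x', u x' t₀ ≤ u x₀ t₀ := by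
      intro x'
      have := hm' x' t₀ ht₀
      simp only [hφ] at this
      exact le_of_mul_le_mul_left (by linarith) (Real.exp_pos (-c * t₀))
    obtain ⟨d, hd, hdle⟩ := hmax x₀ t₀ ⟨hpos, ht₀.2.trans_lt hS.2⟩ hsp
    have hder : HasDerivAt (fun s => φ (x₀, s))
        (Real.exp (-c * t₀) * (-c) * u x₀ t₀ + Real.exp (-c * t₀) * d - ε) t₀ := by
      have h1 : HasDerivAt (fun s : ℝ => Real.exp (-c * s)) (Real.exp (-c * t₀) * (-c)) t₀ := by
        simpa using ((hasDerivAt_id t₀).const_mul (-c)).exp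
      have h2 : HasDerivAt (fun s : ℝ => ε * s) ε t₀ := by
        simpa using (hasDerivAt_id t₀).const_mul ε
      exact (h1.mul hd).sub h2
    have hneg : Real.exp (-c * t₀) * (-c) * u x₀ t₀ + Real.exp (-c * t₀) * d - ε < 0 := by
      have := mul_le_mul_of_nonneg_left hdle (Real.exp_pos (-c * t₀)).le
      nlinarith
    -- Only earlier times are compared, since `t₀` may equal `S`. Left difference quotients at the
    -- maximum are nonnegative, against the negative derivative.
    have hev : ∀ᶠ s in 𝓝[<] t₀, φ (x₀, s) ≤ φ (x₀, t₀) := by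
      filter_upwards [Ioo_mem_nhdsLT hpos] with s hs
      exact hm' x₀ s ⟨hs.1.le, hs.2.le.trans ht₀.2⟩
    have hlim : Tendsto (slope (fun s => φ (x₀, s)) t₀) (𝓝[<] t₀)
        (𝓝 (Real.exp (-c * t₀) * (-c) * u x₀ t₀ + Real.exp (-c * t₀) * d - ε)) :=
      (hasDerivAt_iff_tendsto_slope.1 hder).mono_left
        (nhdsWithin_mono _ fun s hs => ne_of_lt hs)
    have hge := ge_of_tendsto hlim (b := 0) (by
      filter_upwards [hev, self_mem_nhdsWithin] with s hs hs'
      rw [slope_def_field]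
      exact div_nonneg_of_nonpos (by linarith) (by linarith [mem_Iio.1 hs']))
    linarith
  have hopen : ∀ S ∈ Ioo 0 T, u x S ≤ K * Real.exp (c * S) := by
    intro S hS
    have h1 : Real.exp (-c * S) * u x S ≤ K := by
      refine le_of_forall_pos_le_add fun δ hδ => ?_
      have := key S hS (δ / S) (div_pos hδ hS.1) x
      rw [div_mul_cancel₀ _ hS.1.ne'] at this
      linarith
    have h2 := mul_le_mul_of_nonneg_right h1 (Real.exp_pos (c * S)).le
    rwa [mul_right_comm, ← Real.exp_add, neg_mul, neg_add_cancel, Real.exp_zero, one_mul] at h2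
  have hx : ContinuousOn (fun s => u x s) (Icc 0 T) :=
    hu.comp (f := fun s : ℝ => (x, s)) (by fun_prop) fun s hs => ⟨mem_univ _, hs⟩
  have hcl : closure (Ioo 0 T) = Icc 0 T := closure_Ioo hT.ne
  refine ContinuousWithinAt.closure_le (s := Ioo 0 T) (f := fun s => u x s)
    (g := fun s => K * Real.exp (c * s)) (by rwa [hcl])
    ((hx t ht).mono Ioo_subset_Icc_self) (by fun_prop) hopen

/-! ### Partial derivatives in Euclidean space -/

section Calculus

variable {n : ℕ} {U : Set (EuclideanSpace ℝ (Fin n))} {f g : EuclideanSpace ℝ (Fin n) → ℝ}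
  {y : EuclideanSpace ℝ (Fin n)}

theorem differentiableAt_of_contDiffOn (hU : IsOpen U) (hf : ContDiffOn ℝ ∞ f U) (hy : y ∈ U) :
    DifferentiableAt ℝ f y :=
  (hf.contDiffAt (hU.mem_nhds hy)).differentiableAt (by simp)

theorem contDiffOn_pderiv (hU : IsOpen U) (i : Fin n) (hf : ContDiffOn ℝ ∞ f U) :
    ContDiffOn ℝ ∞ (pderiv i f) U :=
  (hf.fderiv_of_isOpen hU (m := ∞) (by simp)).clm_apply contDiffOn_const

theorem pderiv_congr (hU : IsOpen U) (h : EqOn f g U) (hy : y ∈ U) (i : Fin n) :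
    pderiv i f y = pderiv i g y := by
  have : f =ᶠ[𝓝 y] g := by filter_upwards [hU.mem_nhds hy] with z hz using h hz
  simp only [pderiv, this.fderiv_eq]

@[simp] theorem pderiv_const (i : Fin n) (c : ℝ) : pderiv i (fun _ => c) y = 0 := by
  simp [pderiv]

theorem pderiv_add (hf : DifferentiableAt ℝ f y) (hg : DifferentiableAt ℝ g y) (i : Fin n) :
    pderiv i (fun z => f z + g z) y = pderiv i f y + pderiv i g y := by
  simp [pderiv, fderiv_fun_add hf hg]

theorem pderiv_sub (hf : DifferentiableAt ℝ f y) (hg : DifferentiableAt ℝ g y) (i : Fin n) :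
    pderiv i (fun z => f z - g z) y = pderiv i f y - pderiv i g y := by
  simp [pderiv, fderiv_fun_sub hf hg]

theorem pderiv_mul (hf : DifferentiableAt ℝ f y) (hg : DifferentiableAt ℝ g y) (i : Fin n) :
    pderiv i (fun z => f z * g z) y = pderiv i f y * g y + f y * pderiv i g y := by
  simp [pderiv, fderiv_fun_mul hf hg]; ring

theorem pderiv_const_mul (hf : DifferentiableAt ℝ f y) (c : ℝ) (i : Fin n) :
    pderiv i (fun z => c * f z) y = c * pderiv i f y := by
  simp [pderiv, fderiv_const_mul hf]

theorem pderiv_sum {ι : Type*} {s : Finset ι} {F : ι → EuclideanSpace ℝ (Fin n) → ℝ}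
    (hF : ∀ a ∈ s, DifferentiableAt ℝ (F a) y) (i : Fin n) :
    pderiv i (fun z => ∑ a ∈ s, F a z) y = ∑ a ∈ s, pderiv i (F a) y := by
  simp [pderiv, fderiv_fun_sum hF]

theorem pderiv_comm (hU : IsOpen U) (hf : ContDiffOn ℝ ∞ f U) (hy : y ∈ U) (i j : Fin n) :
    pderiv i (pderiv j f) y = pderiv j (pderiv i f) y := by
  have hf' : DifferentiableAt ℝ (fderiv ℝ f) y :=
    ((hf.fderiv_of_isOpen hU (m := ∞) (by simp)).contDiffAt (hU.mem_nhds hy)).differentiableAt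
      (by simp)
  have hs : IsSymmSndFDerivAt ℝ f y :=
    (hf.contDiffAt (hU.mem_nhds hy)).isSymmSndFDerivAt
      (by simpa using (WithTop.coe_le_coe.2 le_top : ((2 : ℕ∞) : WithTop ℕ∞) ≤ ∞))
  have h : ∀ a b : Fin n, pderiv a (pderiv b f) y =
      fderiv ℝ (fderiv ℝ f) y (EuclideanSpace.single a 1) (EuclideanSpace.single b 1) := by
    intro a b
    change fderiv ℝ (fun z => fderiv ℝ f z (EuclideanSpace.single b 1)) y _ = _
    rw [fderiv_clm_apply hf' (by fun_prop)]
    simp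
  rw [h, h, hs]

theorem pderiv_pderiv_mul (hU : IsOpen U) (hf : ContDiffOn ℝ ∞ f U) (hg : ContDiffOn ℝ ∞ g U)
    (hy : y ∈ U) (i : Fin n) :
    pderiv i (pderiv i fun z => f z * g z) y = pderiv i (pderiv i f) y * g y
      + 2 * (pderiv i f y * pderiv i g y) + f y * pderiv i (pderiv i g) y := by
  have hd {h} (hh : ContDiffOn ℝ ∞ h U) {z} (hz : z ∈ U) : DifferentiableAt ℝ h z :=
    differentiableAt_of_contDiffOn hU hh hz
  have hf' := contDiffOn_pderiv hU i hf
  have hg' := contDiffOn_pderiv hU i hg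
  rw [pderiv_congr hU (g := fun z => pderiv i f z * g z + f z * pderiv i g z)
      (fun z hz => pderiv_mul (hd hf hz) (hd hg hz) i) hy,
    pderiv_add (hd (hf'.mul hg) hy) (hd (hf.mul hg') hy),
    pderiv_mul (hd hf' hy) (hd hg hy), pderiv_mul (hd hf hy) (hd hg' hy)]
  ring

theorem pderiv_pderiv_sum {ι : Type*} {s : Finset ι} {F : ι → EuclideanSpace ℝ (Fin n) → ℝ}
    (hU : IsOpen U) (hF : ∀ a ∈ s, ContDiffOn ℝ ∞ (F a) U) (hy : y ∈ U) (i j : Fin n) :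
    pderiv i (pderiv j fun z => ∑ a ∈ s, F a z) y = ∑ a ∈ s, pderiv i (pderiv j (F a)) y := by
  rw [pderiv_congr hU (g := fun z => ∑ a ∈ s, pderiv j (F a) z)
      (fun z hz => pderiv_sum (fun a ha => differentiableAt_of_contDiffOn hU (hF a ha) hz) j) hy,
    pderiv_sum fun a ha => differentiableAt_of_contDiffOn hU (contDiffOn_pderiv hU j (hF a ha)) hy]

/-- Restrict to the coordinate line through `y`. A positive second derivative would make the point a
local minimum as well, so the restriction would be locally constant and its second derivative zero.
-/
theorem pderiv_pderiv_nonpos_of_isLocalMax (hU : IsOpen U) (hf : ContDiffOn ℝ ∞ f U) (hy : y ∈ U)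
    (hm : IsLocalMax f y) (i : Fin n) : pderiv i (pderiv i f) y ≤ 0 := by
  by_contra! hpos
  set v : EuclideanSpace ℝ (Fin n) := EuclideanSpace.single i 1 with hv
  set l : ℝ → EuclideanSpace ℝ (Fin n) := fun s => y + s • v with hl
  have hlc : Continuous l := by fun_prop
  have hl0 : l 0 = y := by simp [hl]
  have hld : ∀ s, HasDerivAt l v s := fun s => by
    have h := ((hasDerivAt_id s).smul_const v).const_add y
    rw [one_smul] at h
    exact h
  have hev : ∀ᶠ s in 𝓝 (0 : ℝ), l s ∈ U :=
    hlc.continuousAt.eventually (by rw [hl0]; exact hU.mem_nhds hy)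
  have hcomp : ∀ h : EuclideanSpace ℝ (Fin n) → ℝ, ContDiffOn ℝ ∞ h U → ∀ s, l s ∈ U →
      HasDerivAt (fun s => h (l s)) (pderiv i h (l s)) s := fun h hh s hs =>
    (differentiableAt_of_contDiffOn hU hh hs).hasFDerivAt.comp_hasDerivAt s (hld s)
  have hd1 : deriv (fun s => f (l s)) =ᶠ[𝓝 0] fun s => pderiv i f (l s) := by
    filter_upwards [hev] with s hs using (hcomp f hf s hs).deriv
  have hd2 : deriv (deriv fun s => f (l s)) 0 = pderiv i (pderiv i f) y := by
    rw [hd1.deriv_eq, (hcomp _ (contDiffOn_pderiv hU i hf) 0 hev.self_of_nhds).deriv, hl0]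
  have hmax : IsLocalMax (fun s => f (l s)) 0 := by
    have : Tendsto l (𝓝 0) (𝓝 y) := hl0 ▸ hlc.tendsto 0
    simpa [IsLocalMax, IsMaxFilter, hl0] using this.eventually hm
  have hmin := isLocalMin_of_deriv_deriv_pos (hd2 ▸ hpos) hmax.deriv_eq_zero
    (hcomp f hf 0 hev.self_of_nhds).continuousAt
  have hconst : (fun s => f (l s)) =ᶠ[𝓝 0] fun _ => f (l 0) := by
    filter_upwards [hmax, hmin] with s h1 h2 using le_antisymm h1 h2
  have h0 : deriv (fun s => f (l s)) =ᶠ[𝓝 0] fun _ => 0 := by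
    simpa using hconst.deriv
  rw [h0.deriv_eq, deriv_const] at hd2
  exact hpos.ne hd2

/-- Time derivatives commute with spatial partial derivatives. -/
theorem hasDerivAt_pderiv {b : EuclideanSpace ℝ (Fin n) × ℝ → ℝ} {t : ℝ}
    (hb : ContDiffAt ℝ ∞ b (y, t)) {τ : EuclideanSpace ℝ (Fin n) → ℝ}
    (hτ : ∀ᶠ z in 𝓝 y, HasDerivAt (fun s => b (z, s)) (τ z) t) (i : Fin n) :
    HasDerivAt (fun s => pderiv i (fun z => b (z, s)) y) (pderiv i τ y) t := by
  have hsymm : IsSymmSndFDerivAt ℝ b (y, t) := hb.isSymmSndFDerivAt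
      (by simpa using (WithTop.coe_le_coe.2 le_top : ((2 : ℕ∞) : WithTop ℕ∞) ≤ ∞))
  have hdiff : ∀ᶠ z in 𝓝 (y, t), DifferentiableAt ℝ b z := by
    filter_upwards [(hb.of_le (m := 1) (WithTop.coe_le_coe.2 le_top)).eventually (by simp)] with z hz
    exact hz.differentiableAt (by simp)
  have hb' : DifferentiableAt ℝ (fderiv ℝ b) (y, t) :=
    (hb.fderiv_right (m := 1) (WithTop.coe_le_coe.2 le_top)).differentiableAt (by simp)
  have ht : Tendsto (fun s : ℝ => (y, s)) (𝓝 t) (𝓝 (y, t)) :=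
    (Continuous.tendsto (by fun_prop) t)
  have hy : Tendsto (fun z => (z, t)) (𝓝 y) (𝓝 (y, t)) :=
    (Continuous.tendsto (by fun_prop) y)
  have dy : ∀ z s, HasFDerivAt (fun z : EuclideanSpace ℝ (Fin n) => (z, s))
      (ContinuousLinearMap.inl ℝ (EuclideanSpace ℝ (Fin n)) ℝ) z := fun z s =>
    hasFDerivAt_prodMk_left z s
  have dt : ∀ z s, HasDerivAt (fun s : ℝ => (z, s)) ((0 : EuclideanSpace ℝ (Fin n)), (1 : ℝ)) s :=
    fun z s => (hasDerivAt_const s z).prodMk (hasDerivAt_id s)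
  have h1 : (fun s => pderiv i (fun z => b (z, s)) y) =ᶠ[𝓝 t]
      fun s => fderiv ℝ b (y, s) (EuclideanSpace.single i 1, 0) := by
    filter_upwards [ht.eventually hdiff] with s hs
    have := (hs.hasFDerivAt.comp y (dy y s)).fderiv
    simp only [pderiv]
    rw [show (fun z => b (z, s)) = b ∘ fun z => (z, s) from rfl, this]
    simp
  have h2 : τ =ᶠ[𝓝 y] fun z => fderiv ℝ b (z, t) (0, 1) := by
    filter_upwards [hy.eventually hdiff, hτ] with z hz hz'
    exact hz'.unique (hz.hasFDerivAt.comp_hasDerivAt t (dt z t))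
  have h3 : HasDerivAt (fun s => fderiv ℝ b (y, s) (EuclideanSpace.single i 1, 0))
      (fderiv ℝ (fderiv ℝ b) (y, t) (0, 1) (EuclideanSpace.single i 1, 0)) t := by
    have := (hb'.hasFDerivAt.comp_hasDerivAt t (dt y t)).clm_apply
      (hasDerivAt_const t ((EuclideanSpace.single i 1, 0) : EuclideanSpace ℝ (Fin n) × ℝ))
    simpa using this
  have h4 : pderiv i τ y =
      fderiv ℝ (fderiv ℝ b) (y, t) (EuclideanSpace.single i 1, 0) (0, 1) := by
    have := (hb'.hasFDerivAt.comp y (dy y t)).clm_apply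
      (hasFDerivAt_const ((0, 1) : EuclideanSpace ℝ (Fin n) × ℝ) y)
    simp only [pderiv]
    rw [h2.fderiv_eq]
    have h5 := this.fderiv
    simp only [Function.comp_def] at h5
    rw [h5]
    simp
  rw [h4, hsymm]
  exact h3.congr_of_eventuallyEq h1

end Calculus

/-! ### Pointwise tensor algebra of the evolution inequalities -/

section TensorAlgebra

variable {ι : Type*} [Fintype ι]

theorem sum_swap_first (f : ι → ι → ι → ℝ) : ∑ i, ∑ j, ∑ k, f i j k = ∑ i, ∑ j, ∑ k, f j i k :=
  Finset.sum_comm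

theorem sum_swap_last (f : ι → ι → ι → ℝ) : ∑ i, ∑ j, ∑ k, f i j k = ∑ i, ∑ j, ∑ k, f i k j :=
  Finset.sum_congr rfl fun _ _ => Finset.sum_comm

/-- With `T i j = ∂_i a_j` the bracket is the exterior derivative of `a`. Each of its terms
contributes equally against a skew `f`. -/
theorem sum_mul_alternation₂ {f : ι → ι → ℝ} (hf : ∀ i j, f i j = -f j i) (T : ι → ι → ℝ) :
    ∑ i, ∑ j, f i j * (T i j - T j i) = 2 * ∑ i, ∑ j, f i j * T i j := by
  have h : ∑ i, ∑ j, f i j * T j i = -∑ i, ∑ j, f i j * T i j := by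
    rw [Finset.sum_comm]
    simp only [← Finset.sum_neg_distrib]
    exact Finset.sum_congr rfl fun i _ => Finset.sum_congr rfl fun j _ => by rw [hf j i]; ring
  simp only [mul_sub, Finset.sum_sub_distrib, h]
  ring

theorem sum_mul_alternation₃ {h : ι → ι → ι → ℝ} (h₁ : ∀ i j k, h i j k = -h j i k)
    (h₂ : ∀ i j k, h i j k = -h i k j) (T : ι → ι → ι → ℝ) :
    ∑ i, ∑ j, ∑ k, h i j k * (T i j k - T j i k + T k i j) =
      3 * ∑ i, ∑ j, ∑ k, h i j k * T i j k := by
  have e₁ : ∑ i, ∑ j, ∑ k, h i j k * T j i k = -∑ i, ∑ j, ∑ k, h i j k * T i j k := by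
    rw [sum_swap_first]
    simp only [← Finset.sum_neg_distrib]
    exact Finset.sum_congr rfl fun i _ => Finset.sum_congr rfl fun j _ =>
      Finset.sum_congr rfl fun k _ => by rw [h₁ j i]; ring
  have e₂ : ∑ i, ∑ j, ∑ k, h i j k * T k i j = ∑ i, ∑ j, ∑ k, h i j k * T i j k := by
    rw [sum_swap_last, sum_swap_first]
    exact Finset.sum_congr rfl fun i _ => Finset.sum_congr rfl fun j _ =>
      Finset.sum_congr rfl fun k _ => by rw [h₂ j k, h₁ j i]; ring
  simp only [mul_sub, mul_add, Finset.sum_sub_distrib, Finset.sum_add_distrib, e₁, e₂]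
  ring

/-- The curvature terms of the evolution equations combine to the Riemann tensor: here `Γ i p j k`
is `∂_i Γ^p_{jk}` and `D k i p` is `∂_k ∂_k g_{ip}`, at a point where `g` is the identity and its
first derivatives vanish. -/
theorem ricci_terms_cancel {Γ R : ι → ι → ι → ι → ℝ} {D : ι → ι → ι → ℝ} {q : ι → ι → ℝ}
    (hD : ∀ k i p, D k i p = Γ k p i k + Γ k i p k)
    (hR : ∀ i j k l, R i j k l = Γ i k j l - Γ j k i l)
    (hq : ∀ i p : ι, q i p = q p i) :
    ∑ i, ∑ p, (2 * ∑ k, R i k p k + ∑ k, D k i p - 2 * ∑ k, Γ i p k k) * q i p = 0 := by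
  -- The relations `hR` and `hD` cancel the `Γ i p k k` terms and reduce the coefficient to `w i p -
  -- w p i`, which is skew and so vanishes against the symmetric `q`.
  set w : ι → ι → ℝ := fun i p => ∑ k, Γ k i p k with hw
  have h : ∀ i p, 2 * ∑ k, R i k p k + ∑ k, D k i p - 2 * ∑ k, Γ i p k k = w i p - w p i := by
    intro i p
    simp only [hw, hR, hD, Finset.sum_sub_distrib, Finset.sum_add_distrib]
    ring
  have h' : ∑ i, ∑ p, w p i * q i p = ∑ i, ∑ p, w i p * q i p := by
    rw [Finset.sum_comm]
    exact Finset.sum_congr rfl fun i _ => Finset.sum_congr rfl fun p _ => by rw [hq p i]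
  simp only [h, sub_mul, Finset.sum_sub_distrib, h', sub_self]

theorem sum_mul_christoffel_trace {Γ : ι → ι → ι → ι → ℝ} {α : Type*} [Fintype α]
    (f : ι → α → ℝ) :
    ∑ i, ∑ a, f i a * ∑ k, ∑ p, Γ i p k k * f p a =
      ∑ i, ∑ p, (∑ k, Γ i p k k) * ∑ a, f i a * f p a := by
  refine Finset.sum_congr rfl fun i _ => ?_
  have h : ∀ a, ∑ k, ∑ p, Γ i p k k * f p a = ∑ p, (∑ k, Γ i p k k) * f p a := fun a => by
    simp only [Finset.sum_mul]
    exact Finset.sum_comm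
  simp only [h, Finset.mul_sum]
  rw [Finset.sum_comm]
  exact Finset.sum_congr rfl fun _ _ => Finset.sum_congr rfl fun _ _ => by ring

/-- Skew symmetry of `f` replaces `Γ i p k j` by its alternation in `i, j`, and that is the
curvature where the Christoffel symbols themselves vanish. -/
theorem two_mul_sum_mul_christoffel {Γ : ι → ι → ι → ι → ℝ} {R : ι → ι → ι → ι → ℝ}
    (hΓ : ∀ i p j k, Γ i p j k = Γ i p k j)
    (hR : ∀ i j k l, R i j k l = Γ i k j l - Γ j k i l) {f : ι → ι → ℝ}
    (hf : ∀ i j, f i j = -f j i) (w : ι → ι → ℝ) :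
    2 * ∑ i, ∑ j, f i j * ∑ k, ∑ p, Γ i p k j * w k p =
      ∑ i, ∑ j, ∑ k, ∑ p, R i j p k * (f i j * w k p) := by
  rw [← sum_mul_alternation₂ hf fun i j => ∑ k, ∑ p, Γ i p k j * w k p]
  refine Finset.sum_congr rfl fun i _ => Finset.sum_congr rfl fun j _ => ?_
  rw [← Finset.sum_sub_distrib, Finset.mul_sum]
  refine Finset.sum_congr rfl fun k _ => ?_
  rw [← Finset.sum_sub_distrib, Finset.mul_sum]
  refine Finset.sum_congr rfl fun p _ => ?_
  rw [hR, hΓ i p k j, hΓ j p k i]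
  ring

/-- The trace of a product of two Gram matrices is the squared norm of the matrix of mixed inner
products. -/
theorem sum_sum_mul_sum_sum_nonneg {α β : Type*} [Fintype α] [Fintype β] (f : ι → α → ℝ)
    (h : ι → β → ℝ) :
    0 ≤ ∑ i, ∑ j, (∑ a, f i a * f j a) * ∑ b, h i b * h j b := by
  have : ∑ i, ∑ j, (∑ a, f i a * f j a) * ∑ b, h i b * h j b =
      ∑ a, ∑ b, (∑ i, f i a * h i b) ^ 2 := by
    simp only [sq, Finset.sum_mul_sum]
    rw [Finset.sum_congr rfl fun i _ => Finset.sum_comm, Finset.sum_comm]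
    refine Finset.sum_congr rfl fun a _ => ?_
    rw [Finset.sum_congr rfl fun i _ => Finset.sum_comm, Finset.sum_comm]
    exact Finset.sum_congr rfl fun b _ => Finset.sum_congr rfl fun i _ =>
      Finset.sum_congr rfl fun j _ => by ring
  rw [this]
  positivity

theorem sum_sum_sum_sum_sq_nonneg (f : ι → ι → ι → ι → ℝ) :
    0 ≤ ∑ i, ∑ j, ∑ k, ∑ l, f i j k l ^ 2 :=
  Finset.sum_nonneg fun _ _ => Finset.sum_nonneg fun _ _ => Finset.sum_nonneg fun _ _ =>
    Finset.sum_nonneg fun _ _ => sq_nonneg _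

/-- Cauchy-Schwarz is used twice: in the passive index `a`, then over the four curvature indices.
Using the full tensor norm of `R` keeps the dimension out of the bound. -/
theorem abs_sum_riemann_mul_le {α : Type*} [Fintype α] {R : ι → ι → ι → ι → ℝ} {K : ℝ}
    (hK : √(∑ i, ∑ j, ∑ k, ∑ l, R i j k l * R i j k l) ≤ K) (f w : ι → ι → α → ℝ)
    (hw : ∑ k, ∑ p, ∑ a, w k p a * w k p a = ∑ i, ∑ j, ∑ a, f i j a * f i j a) :
    |∑ i, ∑ j, ∑ k, ∑ p, ∑ a, R i j p k * (f i j a * w k p a)| ≤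
      K * ∑ i, ∑ j, ∑ a, f i j a * f i j a := by
  set Q : ι → ι → ι → ι → ℝ := fun i j k p => ∑ a, f i j a * w k p a with hQ
  set u := ∑ i, ∑ j, ∑ a, f i j a * f i j a with hu
  have hu0 : 0 ≤ u := by
    simp only [hu, ← sq]; positivity
  have hQu : ∑ i, ∑ j, ∑ k, ∑ p, Q i j k p ^ 2 ≤ u ^ 2 := by
    have h : ∀ i j k p, Q i j k p ^ 2 ≤
        (∑ a, f i j a * f i j a) * ∑ a, w k p a * w k p a := by
      intro i j k p
      simpa only [hQ, ← sq] using Finset.sum_mul_sq_le_sq_mul_sq Finset.univ (f i j) (w k p)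
    calc ∑ i, ∑ j, ∑ k, ∑ p, Q i j k p ^ 2
        ≤ ∑ i, ∑ j, ∑ k, ∑ p, (∑ a, f i j a * f i j a) * ∑ a, w k p a * w k p a := by
          gcongr with i _ j _ k _ p _; exact h i j k p
      _ = u * ∑ k, ∑ p, ∑ a, w k p a * w k p a := by
          simp only [← Finset.mul_sum, ← Finset.sum_mul, hu]
      _ = u ^ 2 := by rw [hw, sq]
  have hR : ∑ i, ∑ j, ∑ k, ∑ p, R i j p k ^ 2 ≤ K ^ 2 := by
    have h0 : 0 ≤ ∑ i, ∑ j, ∑ k, ∑ l, R i j k l * R i j k l := by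
      simpa only [← sq] using sum_sum_sum_sum_sq_nonneg R
    have h1 := (Real.sqrt_le_left ((Real.sqrt_nonneg _).trans hK)).1 hK
    calc ∑ i, ∑ j, ∑ k, ∑ p, R i j p k ^ 2 = ∑ i, ∑ j, ∑ k, ∑ l, R i j k l * R i j k l := by
          refine Finset.sum_congr rfl fun i _ => Finset.sum_congr rfl fun j _ => ?_
          rw [Finset.sum_comm]
          simp only [sq]
      _ ≤ K ^ 2 := h1
  have hcs := Finset.sum_mul_sq_le_sq_mul_sq (Finset.univ : Finset (((ι × ι) × ι) × ι))
    (fun x => R x.1.1.1 x.1.1.2 x.2 x.1.2) (fun x => Q x.1.1.1 x.1.1.2 x.1.2 x.2)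
  simp only [Fintype.sum_prod_type] at hcs
  have heq : ∑ i, ∑ j, ∑ k, ∑ p, ∑ a, R i j p k * (f i j a * w k p a) =
      ∑ i, ∑ j, ∑ k, ∑ p, R i j p k * Q i j k p := by
    simp only [hQ, Finset.mul_sum]
  rw [heq]
  refine abs_le_of_sq_le_sq (hcs.trans ?_) (mul_nonneg ((Real.sqrt_nonneg _).trans hK) hu0)
  rw [mul_pow]
  exact mul_le_mul hR hQu (sum_sum_sum_sum_sq_nonneg _) (sq_nonneg K)

/-- The algebraic part of the evolution inequality for `|F|²`. -/
theorem evolution_inequality₂ {Γ R : ι → ι → ι → ι → ℝ} {D : ι → ι → ι → ℝ} {f τ r : ι → ι → ℝ}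
    {F₁ : ι → ι → ι → ℝ} {F₂ : ι → ι → ι → ι → ℝ} {q : ι → ι → ℝ} {K : ℝ}
    (hf : ∀ i j, f i j = -f j i)
    (hF₂ : ∀ a b i j, F₂ a b i j = -F₂ a b j i)
    (hsymm : ∀ a b i j, F₂ a b i j = F₂ b a i j)
    (hclosed : ∀ k i j, F₂ k k i j - F₂ k i k j + F₂ k j k i = 0)
    (hΓ : ∀ i p j k, Γ i p j k = Γ i p k j)
    (hD : ∀ k i p, D k i p = Γ k p i k + Γ k i p k)
    (hR : ∀ i j k l, R i j k l = Γ i k j l - Γ j k i l)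
    (hK : √(∑ i, ∑ j, ∑ k, ∑ l, R i j k l * R i j k l) ≤ K)
    (hτ : ∀ i j, τ i j = -∑ k, (F₂ i k j k - ∑ p, Γ i p k j * f p k - ∑ p, Γ i p k k * f j p))
    (hq : ∀ i j, q i j = ∑ k, f i k * f j k)
    (hr : 0 ≤ ∑ i, ∑ j, r i j * q i j) :
    2 * ∑ i, ∑ j, f i j * (τ i j - τ j i)
        - 2 * ∑ i, ∑ j, (-2 * (∑ k, R i k j k) + r i j) * q i j ≤
      ∑ m, (2 * ∑ i, ∑ j, F₁ m i j ^ 2 + 2 * ∑ i, ∑ j, f i j * F₂ m m i j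
        - 2 * ∑ i, ∑ j, D m i j * q i j) + 6 * K * ∑ i, ∑ j, f i j * f i j := by
  -- Moving the divergence index to the first slot by skew symmetry absorbs the minus sign of the
  -- flow of `A` and gives the same shape as for 3-forms.
  have hτ' : ∀ i j, τ i j = ∑ k, F₂ k i k j
      - ∑ k, ∑ p, Γ i p k j * f k p - ∑ k, ∑ p, Γ i p k k * f p j := by
    intro i j
    rw [hτ, ← Finset.sum_sub_distrib, ← Finset.sum_sub_distrib, ← Finset.sum_neg_distrib]
    refine Finset.sum_congr rfl fun k _ => ?_
    rw [hF₂, hsymm i k]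
    have e₁ : ∑ p, Γ i p k j * f k p = -∑ p, Γ i p k j * f p k := by
      rw [← Finset.sum_neg_distrib]
      exact Finset.sum_congr rfl fun p _ => by rw [hf k p]; ring
    have e₂ : ∑ p, Γ i p k k * f p j = -∑ p, Γ i p k k * f j p := by
      rw [← Finset.sum_neg_distrib]
      exact Finset.sum_congr rfl fun p _ => by rw [hf p j]; ring
    rw [e₁, e₂]
    ring
  -- Here closedness enters: the alternation of `F₂ k i k j` in `i, j` is `F₂ k k i j`, so the
  -- derivative of the divergence becomes the Laplacian.
  have hlap : 2 * ∑ i, ∑ j, f i j * ∑ k, F₂ k i k j = ∑ k, ∑ i, ∑ j, f i j * F₂ k k i j := by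
    have h : ∑ i, ∑ j, f i j * ∑ k, F₂ k i k j = ∑ k, ∑ i, ∑ j, f i j * F₂ k i k j := by
      simp only [Finset.mul_sum]
      rw [Finset.sum_congr rfl fun i _ => Finset.sum_comm, Finset.sum_comm]
    rw [h, Finset.mul_sum]
    refine Finset.sum_congr rfl fun k _ => ?_
    rw [← sum_mul_alternation₂ hf fun i j => F₂ k i k j]
    exact Finset.sum_congr rfl fun i _ => Finset.sum_congr rfl fun j _ => by
      rw [show F₂ k k i j = F₂ k i k j - F₂ k j k i by linarith [hclosed k i j]]
  have htr : ∑ i, ∑ j, f i j * ∑ k, ∑ p, Γ i p k k * f p j =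
      ∑ i, ∑ p, (∑ k, Γ i p k k) * q i p := by
    rw [sum_mul_christoffel_trace]
    simp only [hq]
  have hcurv := two_mul_sum_mul_christoffel hΓ hR hf f
  have hric := ricci_terms_cancel hD hR (q := q) fun i p => by simp only [hq, mul_comm]
  -- A 2-form has no passive index left, so the index type is a point.
  have hbound := abs_sum_riemann_mul_le (α := Unit) hK (fun i j _ => f i j) (fun i j _ => f i j) rfl
  simp only [Finset.univ_unique, Finset.sum_singleton] at hbound
  have hbound' := (abs_le.1 hbound).1
  have hgrad : 0 ≤ ∑ m, ∑ i, ∑ j, F₁ m i j ^ 2 := by positivity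
  have hDsum : ∑ m, ∑ i, ∑ j, D m i j * q i j = ∑ i, ∑ j, (∑ m, D m i j) * q i j := by
    simp only [Finset.sum_mul]
    rw [Finset.sum_comm]
    exact Finset.sum_congr rfl fun i _ => Finset.sum_comm
  have hu0 : 0 ≤ ∑ i, ∑ j, f i j * f i j := by
    simp only [← sq]; positivity
  have hK0 : 0 ≤ K := (Real.sqrt_nonneg _).trans hK
  -- The curvature contraction appears with coefficient -2, so `2 * K` would suffice for 2-forms.
  -- This nonnegativity supplies the slack up to the `6 * K` shared with 3-forms.
  have hKu := mul_nonneg hK0 hu0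
  rw [sum_mul_alternation₂ hf]
  simp only [hτ', mul_sub, sub_mul, add_mul, Finset.sum_sub_distrib, Finset.sum_add_distrib,
    mul_assoc, ← Finset.mul_sum] at hric htr hcurv hlap hDsum hbound' ⊢
  nlinarith

/-- The algebraic part of the evolution inequality for `|H|²`. -/
theorem evolution_inequality₃ {Γ R : ι → ι → ι → ι → ℝ} {D : ι → ι → ι → ℝ} {r q : ι → ι → ℝ}
    {h τ : ι → ι → ι → ℝ} {H₁ : ι → ι → ι → ι → ℝ} {H₂ : ι → ι → ι → ι → ι → ℝ} {K : ℝ}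
    (h₁ : ∀ i j k, h i j k = -h j i k) (h₂ : ∀ i j k, h i j k = -h i k j)
    (hsymm : ∀ a b i j k, H₂ a b i j k = H₂ b a i j k)
    (hclosed : ∀ k i j m, H₂ k k i j m - H₂ k i k j m + H₂ k j k i m - H₂ k m k i j = 0)
    (hΓ : ∀ i p j k, Γ i p j k = Γ i p k j)
    (hD : ∀ k i p, D k i p = Γ k p i k + Γ k i p k)
    (hR : ∀ i j k l, R i j k l = Γ i k j l - Γ j k i l)
    (hK : √(∑ i, ∑ j, ∑ k, ∑ l, R i j k l * R i j k l) ≤ K)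
    (hτ : ∀ i j m, τ i j m = ∑ k, (H₂ i k k j m - ∑ p, Γ i p k k * h p j m
      - ∑ p, Γ i p k j * h k p m - ∑ p, Γ i p k m * h k j p))
    (hq : ∀ i j, q i j = ∑ k, ∑ l, h i k l * h j k l)
    (hr : 0 ≤ ∑ i, ∑ j, r i j * q i j) :
    2 * ∑ i, ∑ j, ∑ k, h i j k * (τ i j k - τ j i k + τ k i j)
        - 3 * ∑ i, ∑ j, (-2 * (∑ k, R i k j k) + r i j) * q i j ≤
      ∑ m, (2 * ∑ i, ∑ j, ∑ k, H₁ m i j k ^ 2 + 2 * ∑ i, ∑ j, ∑ k, h i j k * H₂ m m i j k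
        - 3 * ∑ i, ∑ j, D m i j * q i j) + 6 * K * ∑ i, ∑ j, ∑ k, h i j k * h i j k := by
  have hτ' : ∀ i j m, τ i j m = ∑ k, H₂ k i k j m - ∑ k, ∑ p, Γ i p k k * h p j m
      - ∑ k, ∑ p, Γ i p k j * h k p m - ∑ k, ∑ p, Γ i p k m * h k j p := by
    intro i j m
    rw [hτ]
    simp only [Finset.sum_sub_distrib, hsymm i]
  have hlap : 3 * ∑ i, ∑ j, ∑ m, h i j m * ∑ k, H₂ k i k j m =
      ∑ k, ∑ i, ∑ j, ∑ m, h i j m * H₂ k k i j m := by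
    have e : ∑ i, ∑ j, ∑ m, h i j m * ∑ k, H₂ k i k j m =
        ∑ k, ∑ i, ∑ j, ∑ m, h i j m * H₂ k i k j m := by
      simp only [Finset.mul_sum]
      rw [Finset.sum_congr rfl fun i _ => (Finset.sum_congr rfl fun j _ => Finset.sum_comm).trans
        Finset.sum_comm, Finset.sum_comm]
    rw [e, Finset.mul_sum]
    refine Finset.sum_congr rfl fun k _ => ?_
    rw [← sum_mul_alternation₃ h₁ h₂ fun i j m => H₂ k i k j m]
    exact Finset.sum_congr rfl fun i _ => Finset.sum_congr rfl fun j _ =>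
      Finset.sum_congr rfl fun m _ => by
        rw [show H₂ k k i j m = H₂ k i k j m - H₂ k j k i m + H₂ k m k i j by
          linarith [hclosed k i j m]]
  have htr : ∑ i, ∑ j, ∑ m, h i j m * ∑ k, ∑ p, Γ i p k k * h p j m =
      ∑ i, ∑ p, (∑ k, Γ i p k k) * q i p := by
    have := sum_mul_christoffel_trace (Γ := Γ) (α := ι × ι) fun i a => h i a.1 a.2
    simp only [Fintype.sum_prod_type] at this
    rw [this]
    simp only [hq]
  -- The connection terms of the two trailing indices agree after exchanging those indices in both
  -- factors. Each is half a curvature contraction, so after the overall factor 6 the total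
  -- coefficient is -6; this is the source of `6 * K`.
  have hlast : ∑ i, ∑ j, ∑ m, h i j m * ∑ k, ∑ p, Γ i p k m * h k j p =
      ∑ i, ∑ j, ∑ m, h i j m * ∑ k, ∑ p, Γ i p k j * h k p m := by
    rw [sum_swap_last]
    refine Finset.sum_congr rfl fun i _ => Finset.sum_congr rfl fun j _ =>
      Finset.sum_congr rfl fun m _ => ?_
    simp only [Finset.mul_sum]
    exact Finset.sum_congr rfl fun k _ => Finset.sum_congr rfl fun p _ => by
      rw [h₂ i m j, h₂ k m p]; ring
  -- For each fixed `m` this is the 2-form identity in the indices `i, j`.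
  have hcurv : 2 * ∑ i, ∑ j, ∑ m, h i j m * ∑ k, ∑ p, Γ i p k j * h k p m =
      ∑ i, ∑ j, ∑ k, ∑ p, ∑ m, R i j p k * (h i j m * h k p m) := by
    rw [Finset.sum_congr rfl fun i _ => Finset.sum_comm, Finset.sum_comm, Finset.mul_sum,
      Finset.sum_congr rfl fun m _ => two_mul_sum_mul_christoffel hΓ hR
        (f := fun i j => h i j m) (fun i j => h₁ i j m) fun k p => h k p m]
    rw [Finset.sum_comm]
    refine Finset.sum_congr rfl fun i _ => ?_
    rw [Finset.sum_comm]
    refine Finset.sum_congr rfl fun j _ => ?_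
    rw [Finset.sum_comm]
    exact Finset.sum_congr rfl fun k _ => Finset.sum_comm
  have hric := ricci_terms_cancel hD hR (q := q) fun i p => by simp only [hq, mul_comm]
  have hbound' := (abs_le.1 (abs_sum_riemann_mul_le hK h h rfl)).1
  have hgrad : 0 ≤ ∑ m, ∑ i, ∑ j, ∑ k, H₁ m i j k ^ 2 := sum_sum_sum_sum_sq_nonneg _
  have hDsum : ∑ m, ∑ i, ∑ j, D m i j * q i j = ∑ i, ∑ j, (∑ m, D m i j) * q i j := by
    simp only [Finset.sum_mul]
    rw [Finset.sum_comm]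
    exact Finset.sum_congr rfl fun i _ => Finset.sum_comm
  rw [sum_mul_alternation₃ h₁ h₂]
  simp only [hτ', mul_sub, sub_mul, add_mul, Finset.sum_sub_distrib, Finset.sum_add_distrib,
    mul_assoc, ← Finset.mul_sum] at hric htr hlast hcurv hlap hDsum hbound' ⊢
  nlinarith

end TensorAlgebra

/-! ### Smoothness and derivative of the inverse matrix -/

section InverseMatrix

variable {n : ℕ}

theorem contDiff_det : ContDiff ℝ ∞ fun X : Fin n → Fin n → ℝ => (Matrix.of X).det := by
  simp only [Matrix.det_apply, Matrix.of_apply]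
  fun_prop

theorem contDiff_adjugate (i j : Fin n) :
    ContDiff ℝ ∞ fun X : Fin n → Fin n → ℝ => (Matrix.of X).adjugate i j := by
  simp only [Matrix.adjugate_apply]
  refine contDiff_det.comp (g := fun X : Fin n → Fin n → ℝ => (Matrix.of X).det)
    (f := fun X : Fin n → Fin n → ℝ => (Matrix.of X).updateRow j (Pi.single i 1)) ?_
  refine contDiff_pi.2 fun k => contDiff_pi.2 fun l => ?_
  by_cases h : k = j
  · simp only [h, Matrix.updateRow_self]
    exact contDiff_const
  · simp only [Matrix.updateRow_ne h, Matrix.of_apply]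
    fun_prop

/-- By Cramer's rule the entries are polynomials divided by the determinant. -/
theorem contDiffAt_inv_apply (i j : Fin n) {X : Fin n → Fin n → ℝ} (hX : (Matrix.of X).det ≠ 0) :
    ContDiffAt ℝ ∞ (fun Y : Fin n → Fin n → ℝ => (Matrix.of Y)⁻¹ i j) X := by
  simp only [Matrix.inv_def, Ring.inverse_eq_inv', Matrix.smul_apply, smul_eq_mul]
  exact (contDiff_det.contDiffAt.inv hX).mul (contDiff_adjugate i j).contDiffAt

/-- Differentiate `G⁻¹ * G = 1` at a time when both factors are the identity. -/
theorem hasDerivAt_inv_apply_of_eq_one {G : ℝ → Matrix (Fin n) (Fin n) ℝ}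
    {G' : Fin n → Fin n → ℝ} {t : ℝ} (hG : ∀ i j, HasDerivAt (fun s => G s i j) (G' i j) t)
    (h1 : G t = 1) (i j : Fin n) : HasDerivAt (fun s => (G s)⁻¹ i j) (-G' i j) t := by
  have hGd : DifferentiableAt ℝ (fun s => (G s : Fin n → Fin n → ℝ)) t :=
    differentiableAt_pi.2 fun i => differentiableAt_pi.2 fun j => (hG i j).differentiableAt
  have hdet : (Matrix.of (G t : Fin n → Fin n → ℝ)).det ≠ 0 := by
    change (G t).det ≠ 0
    simp [h1]
  have hd : ∀ i j, DifferentiableAt ℝ (fun s => (G s)⁻¹ i j) t := fun i j =>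
    ((contDiffAt_inv_apply i j hdet).differentiableAt (by simp)).comp t hGd
  have hev : ∀ᶠ s in 𝓝 t, (G s).det ≠ 0 :=
    (contDiff_det.continuous.continuousAt.comp hGd.continuousAt).eventually_ne hdet
  have hprod : HasDerivAt (fun s => ∑ k, (G s)⁻¹ i k * G s k j)
      (∑ k, (deriv (fun s => (G s)⁻¹ i k) t * G t k j + (G t)⁻¹ i k * G' k j)) t :=
    HasDerivAt.fun_sum fun k _ => (hd i k).hasDerivAt.mul (hG k j)
  have hconst : (fun s => ∑ k, (G s)⁻¹ i k * G s k j) =ᶠ[𝓝 t]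
      fun _ => (1 : Matrix (Fin n) (Fin n) ℝ) i j := by
    filter_upwards [hev] with s hs
    rw [← Matrix.mul_apply, Matrix.nonsing_inv_mul _ (isUnit_iff_ne_zero.2 hs)]
  have h0 := hprod.unique ((hasDerivAt_const t _).congr_of_eventuallyEq hconst)
  simp only [h1, inv_one, Finset.sum_add_distrib, Matrix.one_apply, mul_ite, mul_one, mul_zero,
    ite_mul, one_mul, zero_mul, Finset.sum_ite_eq, Finset.sum_ite_eq', Finset.mem_univ,
    if_true] at h0
  have := (hd i j).hasDerivAt
  rwa [show deriv (fun s => (G s)⁻¹ i j) t = -G' i j by linarith] at this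

end InverseMatrix

/-! ### Derivatives of squared norms at a point where the metric is the identity -/

section NormDerivative

variable {ι : Type*} [Fintype ι] [DecidableEq ι]

/-- This is the product rule evaluated at the identity: `w` is a derivative of the inverse metric,
`X` that of the product of the two form components. By skew symmetry differentiating either metric
factor gives the same contribution, hence the factor 2; for 3-forms it is 3. -/
theorem sum_collapse₂ (w f : ι → ι → ℝ) (hf : ∀ i j, f i j = -f j i)
    (X : ι → ι → ι → ι → ℝ) :
    ∑ i, ∑ j, ∑ a, ∑ b, ((w i a * (1 : Matrix ι ι ℝ) j b + (1 : Matrix ι ι ℝ) i a * w j b)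
        * f i j * f a b + (1 : Matrix ι ι ℝ) i a * (1 : Matrix ι ι ℝ) j b * X i j a b) =
      2 * ∑ i, ∑ j, w i j * (∑ k, f i k * f j k) + ∑ i, ∑ j, X i j i j := by
  simp only [add_mul, Finset.sum_add_distrib, Matrix.one_apply, mul_ite, ite_mul, mul_one, one_mul,
    mul_zero, zero_mul, Finset.sum_ite_eq, Finset.mem_univ, if_true, Finset.sum_ite_irrel,
    Finset.sum_const_zero]
  have e₁ : ∑ i, ∑ j, ∑ a, w i a * f i j * f a j = ∑ i, ∑ j, w i j * ∑ k, f i k * f j k := by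
    refine Finset.sum_congr rfl fun i _ => ?_
    rw [Finset.sum_comm]
    simp only [Finset.mul_sum, mul_assoc]
  have e₂ : ∑ i, ∑ j, ∑ b, w j b * f i j * f i b = ∑ i, ∑ j, w i j * ∑ k, f i k * f j k := by
    rw [← e₁, Finset.sum_comm]
    exact Finset.sum_congr rfl fun j _ => Finset.sum_congr rfl fun i _ =>
      Finset.sum_congr rfl fun b _ => by rw [hf i j, hf i b]; ring
  rw [e₁, e₂]
  ring

theorem sum_collapse₃ (w : ι → ι → ℝ) (h : ι → ι → ι → ℝ) (h₁ : ∀ i j k, h i j k = -h j i k)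
    (h₂ : ∀ i j k, h i j k = -h i k j) (X : ι → ι → ι → ι → ι → ι → ℝ) :
    ∑ i, ∑ j, ∑ k, ∑ a, ∑ b, ∑ c,
      ((w i a * (1 : Matrix ι ι ℝ) j b * (1 : Matrix ι ι ℝ) k c
          + (1 : Matrix ι ι ℝ) i a * w j b * (1 : Matrix ι ι ℝ) k c
          + (1 : Matrix ι ι ℝ) i a * (1 : Matrix ι ι ℝ) j b * w k c) * h i j k * h a b c
        + (1 : Matrix ι ι ℝ) i a * (1 : Matrix ι ι ℝ) j b * (1 : Matrix ι ι ℝ) k c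
          * X i j k a b c) =
      3 * ∑ i, ∑ j, w i j * (∑ k, ∑ l, h i k l * h j k l) + ∑ i, ∑ j, ∑ k, X i j k i j k := by
  simp only [add_mul, Finset.sum_add_distrib, Matrix.one_apply, mul_ite, ite_mul, mul_one, one_mul,
    mul_zero, zero_mul, Finset.sum_ite_eq, Finset.mem_univ, if_true, Finset.sum_ite_irrel,
    Finset.sum_const_zero]
  have e₁ : ∑ i, ∑ j, ∑ k, ∑ a, w i a * h i j k * h a j k =
      ∑ i, ∑ j, w i j * ∑ k, ∑ l, h i k l * h j k l := by
    refine Finset.sum_congr rfl fun i _ => ?_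
    rw [Finset.sum_congr rfl fun j _ => Finset.sum_comm, Finset.sum_comm]
    simp only [Finset.mul_sum, mul_assoc]
  have e₂ : ∑ i, ∑ j, ∑ k, ∑ b, w j b * h i j k * h i b k =
      ∑ i, ∑ j, w i j * ∑ k, ∑ l, h i k l * h j k l := by
    rw [← e₁, Finset.sum_comm]
    exact Finset.sum_congr rfl fun j _ => Finset.sum_congr rfl fun i _ =>
      Finset.sum_congr rfl fun k _ => Finset.sum_congr rfl fun b _ => by
        rw [h₁ i j, h₁ i b]; ring
  have e₃ : ∑ i, ∑ j, ∑ k, ∑ c, w k c * h i j k * h i j c =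
      ∑ i, ∑ j, w i j * ∑ k, ∑ l, h i k l * h j k l := by
    rw [← e₂]
    refine Finset.sum_congr rfl fun i _ => ?_
    rw [Finset.sum_comm]
    exact Finset.sum_congr rfl fun k _ => Finset.sum_congr rfl fun j _ =>
      Finset.sum_congr rfl fun c _ => by rw [h₂ i j k, h₂ i j c]; ring
  rw [e₁, e₂, e₃]
  ring

variable {n : ℕ}

theorem hasDerivAt_normSq₂ {P : ℝ → Matrix (Fin n) (Fin n) ℝ} {P' : Fin n → Fin n → ℝ}
    {f : Fin n → Fin n → ℝ → ℝ} {f' : Fin n → Fin n → ℝ} {t : ℝ} (h1 : P t = 1)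
    (hP : ∀ i j, HasDerivAt (fun s => P s i j) (P' i j) t)
    (hf : ∀ i j, HasDerivAt (f i j) (f' i j) t) (hanti : ∀ i j, f i j t = -f j i t) :
    HasDerivAt (fun s => normSq₂ (P s) fun i j => f i j s)
      (2 * ∑ i, ∑ j, f i j t * f' i j
        + 2 * ∑ i, ∑ j, P' i j * ∑ k, f i k t * f j k t) t := by
  have h : HasDerivAt (fun s => normSq₂ (P s) fun i j => f i j s) _ t :=
    HasDerivAt.fun_sum fun i _ => HasDerivAt.fun_sum fun j _ => HasDerivAt.fun_sum fun a _ =>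
      HasDerivAt.fun_sum fun b _ => (((hP i a).mul (hP j b)).mul (hf i j)).mul (hf a b)
  convert h using 1
  have := sum_collapse₂ P' (fun i j => f i j t) hanti
    fun i j a b => f' i j * f a b t + f i j t * f' a b
  rw [show 2 * ∑ i, ∑ j, f i j t * f' i j = ∑ i, ∑ j, (f' i j * f i j t + f i j t * f' i j) by
    simp only [Finset.mul_sum, mul_comm (f' _ _), two_mul], add_comm, ← this]
  exact Finset.sum_congr rfl fun i _ => Finset.sum_congr rfl fun j _ =>
    Finset.sum_congr rfl fun a _ => Finset.sum_congr rfl fun b _ => by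
      simp only [Pi.mul_apply, h1]; ring

theorem hasDerivAt_normSq₃ {P : ℝ → Matrix (Fin n) (Fin n) ℝ} {P' : Fin n → Fin n → ℝ}
    {h : Fin n → Fin n → Fin n → ℝ → ℝ} {h' : Fin n → Fin n → Fin n → ℝ} {t : ℝ} (h1 : P t = 1)
    (hP : ∀ i j, HasDerivAt (fun s => P s i j) (P' i j) t)
    (hh : ∀ i j k, HasDerivAt (h i j k) (h' i j k) t)
    (h₁ : ∀ i j k, h i j k t = -h j i k t) (h₂ : ∀ i j k, h i j k t = -h i k j t) :
    HasDerivAt (fun s => normSq₃ (P s) fun i j k => h i j k s)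
      (2 * ∑ i, ∑ j, ∑ k, h i j k t * h' i j k
        + 3 * ∑ i, ∑ j, P' i j * ∑ k, ∑ l, h i k l t * h j k l t) t := by
  have hd : HasDerivAt (fun s => normSq₃ (P s) fun i j k => h i j k s) _ t :=
    HasDerivAt.fun_sum fun i _ => HasDerivAt.fun_sum fun j _ => HasDerivAt.fun_sum fun k _ =>
      HasDerivAt.fun_sum fun a _ => HasDerivAt.fun_sum fun b _ => HasDerivAt.fun_sum fun c _ =>
        ((((hP i a).mul (hP j b)).mul (hP k c)).mul (hh i j k)).mul (hh a b c)
  convert hd using 1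
  have := sum_collapse₃ P' (fun i j k => h i j k t) h₁ h₂
    fun i j k a b c => h' i j k * h a b c t + h i j k t * h' a b c
  rw [show 2 * ∑ i, ∑ j, ∑ k, h i j k t * h' i j k =
      ∑ i, ∑ j, ∑ k, (h' i j k * h i j k t + h i j k t * h' i j k) by
    simp only [Finset.mul_sum, mul_comm (h' _ _ _), two_mul], add_comm, ← this]
  exact Finset.sum_congr rfl fun i _ => Finset.sum_congr rfl fun j _ =>
    Finset.sum_congr rfl fun k _ => Finset.sum_congr rfl fun a _ =>
    Finset.sum_congr rfl fun b _ => Finset.sum_congr rfl fun c _ => by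
      simp only [Pi.mul_apply, h1]; ring

variable {U : Set (EuclideanSpace ℝ (Fin n))} {y : EuclideanSpace ℝ (Fin n)}
  {P : EuclideanSpace ℝ (Fin n) → Matrix (Fin n) (Fin n) ℝ}

theorem pderiv_pderiv_mul_of_pderiv_eq_zero {f g : EuclideanSpace ℝ (Fin n) → ℝ} (hU : IsOpen U)
    (hf : ContDiffOn ℝ ∞ f U) (hg : ContDiffOn ℝ ∞ g U) (hy : y ∈ U) (i : Fin n)
    (h0 : pderiv i f y = 0) :
    pderiv i (pderiv i fun z => f z * g z) y =
      pderiv i (pderiv i f) y * g y + f y * pderiv i (pderiv i g) y := by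
  rw [pderiv_pderiv_mul hU hf hg hy, h0]
  ring

theorem pderiv_mul_eq_zero {f g : EuclideanSpace ℝ (Fin n) → ℝ} (hU : IsOpen U)
    (hf : ContDiffOn ℝ ∞ f U) (hg : ContDiffOn ℝ ∞ g U) (hy : y ∈ U) (i : Fin n)
    (hf0 : pderiv i f y = 0) (hg0 : pderiv i g y = 0) : pderiv i (fun z => f z * g z) y = 0 := by
  rw [pderiv_mul (differentiableAt_of_contDiffOn hU hf hy)
    (differentiableAt_of_contDiffOn hU hg hy), hf0, hg0]
  ring

/-- Since first derivatives of `P` vanish at `y`, no mixed products of a derivative of `P` with a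
derivative of `f` survive. -/
theorem pderiv_pderiv_normSq₂ (hU : IsOpen U) (hy : y ∈ U)
    (hP : ∀ i j, ContDiffOn ℝ ∞ (fun z => P z i j) U) (h1 : P y = 1) (m : Fin n)
    (hP0 : ∀ i j, pderiv m (fun z => P z i j) y = 0)
    {f : Fin n → Fin n → EuclideanSpace ℝ (Fin n) → ℝ} (hf : ∀ i j, ContDiffOn ℝ ∞ (f i j) U)
    (hanti : ∀ i j, f i j y = -f j i y) :
    pderiv m (pderiv m fun z => normSq₂ (P z) fun i j => f i j z) y =
      2 * ∑ i, ∑ j, pderiv m (f i j) y ^ 2 + 2 * ∑ i, ∑ j, f i j y * pderiv m (pderiv m (f i j)) y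
        + 2 * ∑ i, ∑ j, pderiv m (pderiv m fun z => P z i j) y * ∑ k, f i k y * f j k y := by
  have hPP i j a b := (hP i a).mul (hP j b)
  have hPPf i j a b := (hPP i j a b).mul (hf i j)
  have hterm : ∀ i j a b, pderiv m (pderiv m fun z => P z i a * P z j b * f i j z * f a b z) y =
      (pderiv m (pderiv m fun z => P z i a) y * (1 : Matrix (Fin n) (Fin n) ℝ) j b
        + (1 : Matrix (Fin n) (Fin n) ℝ) i a * pderiv m (pderiv m fun z => P z j b) y)
        * f i j y * f a b y
      + (1 : Matrix (Fin n) (Fin n) ℝ) i a * (1 : Matrix (Fin n) (Fin n) ℝ) j b *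
        (pderiv m (pderiv m (f i j)) y * f a b y + 2 * (pderiv m (f i j) y * pderiv m (f a b) y)
          + f i j y * pderiv m (pderiv m (f a b)) y) := by
    intro i j a b
    have := pderiv_pderiv_mul_of_pderiv_eq_zero hU (hPP i j a b) ((hf i j).mul (hf a b)) hy m
      (pderiv_mul_eq_zero hU (hP i a) (hP j b) hy m (hP0 i a) (hP0 j b))
    simp only [mul_assoc] at this ⊢
    rw [this, pderiv_pderiv_mul_of_pderiv_eq_zero hU (hP i a) (hP j b) hy m (hP0 i a),
      pderiv_pderiv_mul hU (hf i j) (hf a b) hy, h1]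
  have hs₁ i j a := fun b (_ : b ∈ (Finset.univ : Finset (Fin n))) => (hPPf i j a b).mul (hf a b)
  have hs₂ i j := fun a (_ : a ∈ (Finset.univ : Finset (Fin n))) => ContDiffOn.sum (hs₁ i j a)
  have hs₃ i := fun j (_ : j ∈ (Finset.univ : Finset (Fin n))) => ContDiffOn.sum (hs₂ i j)
  have hs₄ := fun i (_ : i ∈ (Finset.univ : Finset (Fin n))) => ContDiffOn.sum (hs₃ i)
  unfold normSq₂
  rw [pderiv_pderiv_sum hU hs₄ hy]
  simp only [pderiv_pderiv_sum hU (hs₃ _) hy, pderiv_pderiv_sum hU (hs₂ _ _) hy,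
    pderiv_pderiv_sum hU (hs₁ _ _ _) hy, hterm]
  rw [sum_collapse₂ _ _ hanti]
  simp only [Finset.sum_add_distrib, ← Finset.mul_sum, sq, mul_comm (pderiv m (pderiv m (f _ _)) y)]
  ring

theorem pderiv_pderiv_normSq₃ (hU : IsOpen U) (hy : y ∈ U)
    (hP : ∀ i j, ContDiffOn ℝ ∞ (fun z => P z i j) U) (h1 : P y = 1) (m : Fin n)
    (hP0 : ∀ i j, pderiv m (fun z => P z i j) y = 0)
    {h : Fin n → Fin n → Fin n → EuclideanSpace ℝ (Fin n) → ℝ}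
    (hh : ∀ i j k, ContDiffOn ℝ ∞ (h i j k) U)
    (h₁ : ∀ i j k, h i j k y = -h j i k y) (h₂ : ∀ i j k, h i j k y = -h i k j y) :
    pderiv m (pderiv m fun z => normSq₃ (P z) fun i j k => h i j k z) y =
      2 * ∑ i, ∑ j, ∑ k, pderiv m (h i j k) y ^ 2
        + 2 * ∑ i, ∑ j, ∑ k, h i j k y * pderiv m (pderiv m (h i j k)) y
        + 3 * ∑ i, ∑ j, pderiv m (pderiv m fun z => P z i j) y
          * ∑ k, ∑ l, h i k l y * h j k l y := by
  have hPP i j a b := (hP i a).mul (hP j b)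
  have hPPP i j k a b c := (hPP i j a b).mul (hP k c)
  have hPPPh i j k a b c := (hPPP i j k a b c).mul (hh i j k)
  have hterm : ∀ i j k a b c,
      pderiv m (pderiv m fun z => P z i a * P z j b * P z k c * h i j k z * h a b c z) y =
      (pderiv m (pderiv m fun z => P z i a) y * (1 : Matrix (Fin n) (Fin n) ℝ) j b
          * (1 : Matrix (Fin n) (Fin n) ℝ) k c
        + (1 : Matrix (Fin n) (Fin n) ℝ) i a * pderiv m (pderiv m fun z => P z j b) y
          * (1 : Matrix (Fin n) (Fin n) ℝ) k c
        + (1 : Matrix (Fin n) (Fin n) ℝ) i a * (1 : Matrix (Fin n) (Fin n) ℝ) j b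
          * pderiv m (pderiv m fun z => P z k c) y) * h i j k y * h a b c y
      + (1 : Matrix (Fin n) (Fin n) ℝ) i a * (1 : Matrix (Fin n) (Fin n) ℝ) j b
          * (1 : Matrix (Fin n) (Fin n) ℝ) k c *
        (pderiv m (pderiv m (h i j k)) y * h a b c y
          + 2 * (pderiv m (h i j k) y * pderiv m (h a b c) y)
          + h i j k y * pderiv m (pderiv m (h a b c)) y) := by
    intro i j k a b c
    have h0 := pderiv_mul_eq_zero hU (hP i a) (hP j b) hy m (hP0 i a) (hP0 j b)
    have e₁ := pderiv_pderiv_mul_of_pderiv_eq_zero hU (hPPP i j k a b c)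
      ((hh i j k).mul (hh a b c)) hy m (pderiv_mul_eq_zero hU (hPP i j a b) (hP k c) hy m h0
        (hP0 k c))
    have e₂ := pderiv_pderiv_mul_of_pderiv_eq_zero hU (hPP i j a b) (hP k c) hy m h0
    simp only [mul_assoc] at e₁ e₂ ⊢
    have e₃ := pderiv_pderiv_mul_of_pderiv_eq_zero hU (hP i a) (hP j b) hy m (hP0 i a)
    rw [e₁, e₂, e₃, pderiv_pderiv_mul hU (hh i j k) (hh a b c) hy, h1]
    ring
  have hs₁ i j k a b := fun c (_ : c ∈ (Finset.univ : Finset (Fin n))) =>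
    (hPPPh i j k a b c).mul (hh a b c)
  have hs₂ i j k a := fun b (_ : b ∈ (Finset.univ : Finset (Fin n))) =>
    ContDiffOn.sum (hs₁ i j k a b)
  have hs₃ i j k := fun a (_ : a ∈ (Finset.univ : Finset (Fin n))) =>
    ContDiffOn.sum (hs₂ i j k a)
  have hs₄ i j := fun k (_ : k ∈ (Finset.univ : Finset (Fin n))) => ContDiffOn.sum (hs₃ i j k)
  have hs₅ i := fun j (_ : j ∈ (Finset.univ : Finset (Fin n))) => ContDiffOn.sum (hs₄ i j)
  have hs₆ := fun i (_ : i ∈ (Finset.univ : Finset (Fin n))) => ContDiffOn.sum (hs₅ i)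
  unfold normSq₃
  rw [pderiv_pderiv_sum hU hs₆ hy]
  simp only [pderiv_pderiv_sum hU (hs₅ _) hy, pderiv_pderiv_sum hU (hs₄ _ _) hy,
    pderiv_pderiv_sum hU (hs₃ _ _ _) hy, pderiv_pderiv_sum hU (hs₂ _ _ _ _) hy,
    pderiv_pderiv_sum hU (hs₁ _ _ _ _ _) hy, hterm]
  rw [sum_collapse₃ _ _ h₁ h₂]
  simp only [Finset.sum_add_distrib, ← Finset.mul_sum, sq, mul_comm (pderiv m (pderiv m (h _ _ _)) y)]
  ring

end NormDerivative

/-! ### Squared norms for the identity metric -/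

section NormOne

variable {n : ℕ}

theorem normSq₂_one (f : Fin n → Fin n → ℝ) : normSq₂ 1 f = ∑ i, ∑ j, f i j * f i j := by
  simp [normSq₂, Matrix.one_apply]

theorem normSq₃_one (h : Fin n → Fin n → Fin n → ℝ) :
    normSq₃ 1 h = ∑ i, ∑ j, ∑ k, h i j k * h i j k := by
  simp [normSq₃, Matrix.one_apply]

theorem normSq₄_one (R : Fin n → Fin n → Fin n → Fin n → ℝ) :
    normSq₄ 1 R = ∑ i, ∑ j, ∑ k, ∑ l, R i j k l * R i j k l := by
  simp [normSq₄, Matrix.one_apply]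

end NormOne

/-! ### Curvature and divergences in normal coordinates -/

/-- `G` is a smooth metric on the open set `U` which at `y ∈ U` is the identity to first order. -/
structure IsNormalAt {n : ℕ} (G : EuclideanSpace ℝ (Fin n) → Matrix (Fin n) (Fin n) ℝ)
    (U : Set (EuclideanSpace ℝ (Fin n))) (y : EuclideanSpace ℝ (Fin n)) : Prop where
  isOpen : IsOpen U
  mem : y ∈ U
  smooth : ∀ i j, ContDiffOn ℝ ∞ (fun z => G z i j) U
  det_ne_zero : ∀ z ∈ U, (G z).det ≠ 0
  symm : ∀ z ∈ U, ∀ i j, G z i j = G z j i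
  eq_one : G y = 1
  pderiv_eq_zero : ∀ m i j, pderiv m (fun z => G z i j) y = 0

/-- The domain is a general normed space because this is used both on a spatial chart and on
space-time, including the end times. -/
theorem contDiffOn_inv_apply {n : ℕ} {V : Type*} [NormedAddCommGroup V] [NormedSpace ℝ V]
    {G : V → Matrix (Fin n) (Fin n) ℝ} {U : Set V}
    (hG : ∀ i j, ContDiffOn ℝ ∞ (fun z => G z i j) U) (hdet : ∀ z ∈ U, (G z).det ≠ 0)
    (i j : Fin n) : ContDiffOn ℝ ∞ (fun z => (G z)⁻¹ i j) U := by
  intro z hz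
  have h : ContDiffWithinAt ℝ ∞ (fun z => (fun i j => G z i j : Fin n → Fin n → ℝ)) U z :=
    contDiffWithinAt_pi.2 fun i => contDiffWithinAt_pi.2 fun j => hG i j z hz
  exact (contDiffAt_inv_apply i j (X := fun i j => G z i j) (hdet z hz)).comp_contDiffWithinAt z h

namespace IsNormalAt

variable {n : ℕ} {G : EuclideanSpace ℝ (Fin n) → Matrix (Fin n) (Fin n) ℝ}
  {U : Set (EuclideanSpace ℝ (Fin n))} {y : EuclideanSpace ℝ (Fin n)}

theorem contDiffOn_inv (hG : IsNormalAt G U y) (i j : Fin n) :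
    ContDiffOn ℝ ∞ (fun z => (G z)⁻¹ i j) U :=
  contDiffOn_inv_apply hG.smooth hG.det_ne_zero i j

theorem inv_eq_one (hG : IsNormalAt G U y) : (G y)⁻¹ = 1 := by rw [hG.eq_one, inv_one]

theorem sum_inv_mul (hG : IsNormalAt G U y) (i j : Fin n) :
    EqOn (fun z => ∑ k, (G z)⁻¹ i k * G z k j) (fun _ => (1 : Matrix (Fin n) (Fin n) ℝ) i j) U := by
  intro z hz
  simp only
  rw [← Matrix.mul_apply, Matrix.nonsing_inv_mul _ (isUnit_iff_ne_zero.2 (hG.det_ne_zero z hz))]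

theorem pderiv_inv (hG : IsNormalAt G U y) (m i j : Fin n) :
    pderiv m (fun z => (G z)⁻¹ i j) y = 0 := by
  have hd {f} (hf : ContDiffOn ℝ ∞ f U) : DifferentiableAt ℝ f y :=
    differentiableAt_of_contDiffOn hG.isOpen hf hG.mem
  have h := pderiv_congr hG.isOpen (hG.sum_inv_mul i j) hG.mem m
  rw [pderiv_const, pderiv_sum fun k _ => hd ((hG.contDiffOn_inv i k).mul (hG.smooth k j))] at h
  simp only [pderiv_mul (hd (hG.contDiffOn_inv i _)) (hd (hG.smooth _ j)), hG.pderiv_eq_zero,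
    hG.eq_one, Matrix.one_apply, mul_ite, mul_one, mul_zero, add_zero, Finset.sum_ite_eq',
    Finset.mem_univ, if_true] at h
  exact h

/-- Differentiating `G⁻¹ * G = 1` twice, the mixed term drops because first derivatives of `G`
vanish at `y`. -/
theorem pderiv_pderiv_inv (hG : IsNormalAt G U y) (m i j : Fin n) :
    pderiv m (pderiv m fun z => (G z)⁻¹ i j) y = -pderiv m (pderiv m fun z => G z i j) y := by
  have h : pderiv m (pderiv m fun z => ∑ k, (G z)⁻¹ i k * G z k j) y = 0 :=
    (pderiv_congr hG.isOpen (g := fun _ => 0)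
      (fun z hz => (pderiv_congr hG.isOpen (hG.sum_inv_mul i j) hz m).trans (pderiv_const _ _))
      hG.mem m).trans (pderiv_const _ _)
  rw [pderiv_pderiv_sum hG.isOpen
    (fun k _ => (hG.contDiffOn_inv i k).mul (hG.smooth k j)) hG.mem] at h
  simp only [pderiv_pderiv_mul hG.isOpen (hG.contDiffOn_inv i _) (hG.smooth _ j) hG.mem,
    hG.pderiv_eq_zero, hG.eq_one, inv_one, Matrix.one_apply, mul_ite, ite_mul, mul_one,
    mul_zero, one_mul, zero_mul, add_zero, Finset.sum_add_distrib, Finset.sum_ite_eq',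
    Finset.sum_ite_eq, Finset.mem_univ, if_true] at h
  linarith

theorem contDiffOn_christoffel (hG : IsNormalAt G U y) (k i j : Fin n) :
    ContDiffOn ℝ ∞ (christoffel G k i j) U := by
  refine contDiffOn_const.mul (ContDiffOn.sum fun l _ => (hG.contDiffOn_inv k l).mul ?_)
  exact ((contDiffOn_pderiv hG.isOpen i (hG.smooth j l)).add
    (contDiffOn_pderiv hG.isOpen j (hG.smooth i l))).sub
    (contDiffOn_pderiv hG.isOpen l (hG.smooth i j))

theorem christoffel_eq_zero (hG : IsNormalAt G U y) (k i j : Fin n) :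
    christoffel G k i j y = 0 := by
  simp [christoffel, hG.pderiv_eq_zero]

theorem pderiv_christoffel (hG : IsNormalAt G U y) (i p j k : Fin n) :
    pderiv i (christoffel G p j k) y =
      (1 / 2) * (pderiv i (pderiv j fun z => G z k p) y + pderiv i (pderiv k fun z => G z j p) y
        - pderiv i (pderiv p fun z => G z j k) y) := by
  have hd {f} (hf : ContDiffOn ℝ ∞ f U) : DifferentiableAt ℝ f y :=
    differentiableAt_of_contDiffOn hG.isOpen hf hG.mem
  have hp a b c := contDiffOn_pderiv hG.isOpen a (hG.smooth b c)
  have hS l := ((hp j k l).add (hp k j l)).sub (hp l j k)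
  have hPS l := (hG.contDiffOn_inv p l).mul (hS l)
  have e : ∀ l, pderiv i (fun z => (G z)⁻¹ p l * (pderiv j (fun w => G w k l) z
      + pderiv k (fun w => G w j l) z - pderiv l (fun w => G w j k) z)) y =
      if p = l then pderiv i (pderiv j fun z => G z k l) y
        + pderiv i (pderiv k fun z => G z j l) y - pderiv i (pderiv l fun z => G z j k) y
      else 0 := by
    intro l
    rw [pderiv_mul (hd (hG.contDiffOn_inv p l)) (hd (hS l)), hG.pderiv_inv, hG.inv_eq_one,
      pderiv_sub (hd ((hp j k l).add (hp k j l))) (hd (hp l j k)),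
      pderiv_add (hd (hp j k l)) (hd (hp k j l)), Matrix.one_apply]
    simp
  unfold christoffel
  rw [pderiv_const_mul (hd (ContDiffOn.sum fun l _ => hPS l)), pderiv_sum fun l _ => hd (hPS l)]
  simp only [e, Finset.sum_ite_eq, Finset.mem_univ, if_true]

theorem pderiv_pderiv_symm (hG : IsNormalAt G U y) (a b i j : Fin n) :
    pderiv a (pderiv b fun z => G z i j) y = pderiv a (pderiv b fun z => G z j i) y :=
  pderiv_congr hG.isOpen
    (fun _ hz => pderiv_congr hG.isOpen (fun w hw => hG.symm w hw i j) hz b) hG.mem a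

theorem pderiv_christoffel_symm (hG : IsNormalAt G U y) (i p j k : Fin n) :
    pderiv i (christoffel G p j k) y = pderiv i (christoffel G p k j) y := by
  rw [hG.pderiv_christoffel, hG.pderiv_christoffel, hG.pderiv_pderiv_symm i p j k]
  ring

/-- This is the once-differentiated metric compatibility `∇g = 0`; it provides the hypothesis `hD`
of the algebraic inequalities. -/
theorem pderiv_christoffel_add (hG : IsNormalAt G U y) (k i p : Fin n) :
    pderiv k (pderiv k fun z => G z i p) y =
      pderiv k (christoffel G p i k) y + pderiv k (christoffel G i p k) y := by
  rw [hG.pderiv_christoffel, hG.pderiv_christoffel, hG.pderiv_pderiv_symm k i k p,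
    hG.pderiv_pderiv_symm k p k i, hG.pderiv_pderiv_symm k k p i]
  ring

theorem riemann_eq (hG : IsNormalAt G U y) (i j k l : Fin n) :
    riemann G i j k l y =
      pderiv i (christoffel G k j l) y - pderiv j (christoffel G k i l) y := by
  simp [riemann, hG.christoffel_eq_zero, hG.eq_one, Matrix.one_apply]

theorem ricci_eq (hG : IsNormalAt G U y) (i j : Fin n) :
    ricci G i j y = ∑ k, riemann G i k j k y := by
  simp [ricci, hG.inv_eq_one, Matrix.one_apply]

theorem contDiffOn_christoffel_mul (hG : IsNormalAt G U y) {S : EuclideanSpace ℝ (Fin n) → ℝ}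
    (hS : ContDiffOn ℝ ∞ S U) (p a b : Fin n) :
    ContDiffOn ℝ ∞ (fun z => christoffel G p a b z * S z) U :=
  (hG.contDiffOn_christoffel p a b).mul hS

theorem pderiv_sum_christoffel_mul (hG : IsNormalAt G U y)
    {S : Fin n → EuclideanSpace ℝ (Fin n) → ℝ} (hS : ∀ p, ContDiffOn ℝ ∞ (S p) U) (i a b : Fin n) :
    pderiv i (fun z => ∑ p, christoffel G p a b z * S p z) y =
      ∑ p, pderiv i (christoffel G p a b) y * S p y := by
  have hd {f} (hf : ContDiffOn ℝ ∞ f U) : DifferentiableAt ℝ f y :=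
    differentiableAt_of_contDiffOn hG.isOpen hf hG.mem
  rw [pderiv_sum fun p _ => hd (hG.contDiffOn_christoffel_mul (hS p) p a b)]
  exact Finset.sum_congr rfl fun p _ => by
    rw [pderiv_mul (hd (hG.contDiffOn_christoffel p a b)) (hd (hS p)), hG.christoffel_eq_zero]
    ring

theorem pderiv_sum_inv_mul (hG : IsNormalAt G U y)
    {S : Fin n → Fin n → EuclideanSpace ℝ (Fin n) → ℝ} (hS : ∀ k l, ContDiffOn ℝ ∞ (S k l) U)
    (i : Fin n) :
    pderiv i (fun z => ∑ k, ∑ l, (G z)⁻¹ k l * S k l z) y = ∑ k, pderiv i (S k k) y := by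
  have hd {f} (hf : ContDiffOn ℝ ∞ f U) : DifferentiableAt ℝ f y :=
    differentiableAt_of_contDiffOn hG.isOpen hf hG.mem
  have h k l := (hG.contDiffOn_inv k l).mul (hS k l)
  rw [pderiv_sum fun k _ => hd (ContDiffOn.sum fun l _ => h k l)]
  refine Finset.sum_congr rfl fun k _ => ?_
  rw [pderiv_sum fun l _ => hd (h k l)]
  simp only [pderiv_mul (hd (hG.contDiffOn_inv k _)) (hd (hS k _)), hG.pderiv_inv, hG.inv_eq_one,
    Matrix.one_apply, zero_mul, zero_add, ite_mul, one_mul, Finset.sum_ite_eq, Finset.mem_univ,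
    if_true]

/-- At `y` the inverse metric is stationary and the Christoffel symbols vanish, so only their
derivatives, multiplied by undifferentiated `S`, are left as corrections. -/
theorem pderiv_divergence₂ (hG : IsNormalAt G U y)
    {S : Fin n → Fin n → EuclideanSpace ℝ (Fin n) → ℝ} (hS : ∀ i j, ContDiffOn ℝ ∞ (S i j) U)
    (i j : Fin n) :
    pderiv i (fun z => ∑ k, ∑ l, (G z)⁻¹ k l * covDeriv₂ G S k j l z) y =
      ∑ k, (pderiv i (pderiv k (S j k)) y - ∑ p, pderiv i (christoffel G p k j) y * S p k y
        - ∑ p, pderiv i (christoffel G p k k) y * S j p y) := by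
  have hd {f} (hf : ContDiffOn ℝ ∞ f U) : DifferentiableAt ℝ f y :=
    differentiableAt_of_contDiffOn hG.isOpen hf hG.mem
  have h₀ k l := contDiffOn_pderiv hG.isOpen k (hS j l)
  have h₁ k l := ContDiffOn.sum (s := Finset.univ) fun p _ =>
    hG.contDiffOn_christoffel_mul (hS p l) p k j
  have h₂ k l := ContDiffOn.sum (s := Finset.univ) fun p _ =>
    hG.contDiffOn_christoffel_mul (hS j p) p k l
  rw [hG.pderiv_sum_inv_mul (S := fun k l => covDeriv₂ G S k j l)
    fun k l => ((h₀ k l).sub (h₁ k l)).sub (h₂ k l)]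
  refine Finset.sum_congr rfl fun k _ => ?_
  unfold covDeriv₂
  rw [pderiv_sub (hd ((h₀ k k).sub (h₁ k k))) (hd (h₂ k k)), pderiv_sub (hd (h₀ k k)) (hd (h₁ k k)),
    hG.pderiv_sum_christoffel_mul fun p => hS p k, hG.pderiv_sum_christoffel_mul fun p => hS j p]

theorem pderiv_divergence₃ (hG : IsNormalAt G U y)
    {S : Fin n → Fin n → Fin n → EuclideanSpace ℝ (Fin n) → ℝ}
    (hS : ∀ i j k, ContDiffOn ℝ ∞ (S i j k) U) (i j m : Fin n) :
    pderiv i (fun z => ∑ k, ∑ l, (G z)⁻¹ k l * covDeriv₃ G S k l j m z) y =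
      ∑ k, (pderiv i (pderiv k (S k j m)) y - ∑ p, pderiv i (christoffel G p k k) y * S p j m y
        - ∑ p, pderiv i (christoffel G p k j) y * S k p m y
        - ∑ p, pderiv i (christoffel G p k m) y * S k j p y) := by
  have hd {f} (hf : ContDiffOn ℝ ∞ f U) : DifferentiableAt ℝ f y :=
    differentiableAt_of_contDiffOn hG.isOpen hf hG.mem
  have h₀ k l := contDiffOn_pderiv hG.isOpen k (hS l j m)
  have h₁ k l := ContDiffOn.sum (s := Finset.univ) fun p _ =>
    hG.contDiffOn_christoffel_mul (hS p j m) p k l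
  have h₂ k l := ContDiffOn.sum (s := Finset.univ) fun p _ =>
    hG.contDiffOn_christoffel_mul (hS l p m) p k j
  have h₃ k l := ContDiffOn.sum (s := Finset.univ) fun p _ =>
    hG.contDiffOn_christoffel_mul (hS l j p) p k m
  rw [hG.pderiv_sum_inv_mul (S := fun k l => covDeriv₃ G S k l j m)
    fun k l => (((h₀ k l).sub (h₁ k l)).sub (h₂ k l)).sub (h₃ k l)]
  refine Finset.sum_congr rfl fun k _ => ?_
  unfold covDeriv₃
  rw [pderiv_sub (hd (((h₀ k k).sub (h₁ k k)).sub (h₂ k k))) (hd (h₃ k k)),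
    pderiv_sub (hd ((h₀ k k).sub (h₁ k k))) (hd (h₂ k k)), pderiv_sub (hd (h₀ k k)) (hd (h₁ k k)),
    hG.pderiv_sum_christoffel_mul fun p => hS p j m, hG.pderiv_sum_christoffel_mul fun p => hS k p m,
    hG.pderiv_sum_christoffel_mul fun p => hS k j p]

/-- At a spatial maximum of `|S|²`, for a closed 2-form `S`, the reaction terms of the evolution
equation of `|S|²` are bounded by the curvature. -/
theorem evolution_le_of_isLocalMax₂ (hG : IsNormalAt G U y)
    {S : Fin n → Fin n → EuclideanSpace ℝ (Fin n) → ℝ} (hS : ∀ i j, ContDiffOn ℝ ∞ (S i j) U)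
    (hanti : ∀ z ∈ U, ∀ i j, S i j z = -S j i z)
    (hclosed : ∀ z ∈ U, ∀ k i j,
      pderiv k (S i j) z - pderiv i (S k j) z + pderiv j (S k i) z = 0)
    {K : ℝ} (hK : √(normSq₄ (G y)⁻¹ fun i j k l => riemann G i j k l y) ≤ K)
    (hmax : IsLocalMax (fun z => normSq₂ (G z)⁻¹ fun i j => S i j z) y)
    {τ r : Fin n → Fin n → ℝ}
    (hτ : ∀ i j, τ i j = pderiv i (fun z => -∑ k, ∑ l, (G z)⁻¹ k l * covDeriv₂ G S k j l z) y)
    (hr : 0 ≤ ∑ i, ∑ j, r i j * ∑ k, S i k y * S j k y) :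
    2 * ∑ i, ∑ j, S i j y * (τ i j - τ j i)
        - 2 * ∑ i, ∑ j, (-2 * ricci G i j y + r i j) * ∑ k, S i k y * S j k y ≤
      6 * K * normSq₂ (G y)⁻¹ fun i j => S i j y := by
  have hU := hG.isOpen
  have hy := hG.mem
  have hsum : ContDiffOn ℝ ∞ (fun z => normSq₂ (G z)⁻¹ fun i j => S i j z) U :=
    ContDiffOn.sum fun i _ => ContDiffOn.sum fun j _ => ContDiffOn.sum fun a _ =>
      ContDiffOn.sum fun b _ =>
        (((hG.contDiffOn_inv i a).mul (hG.contDiffOn_inv j b)).mul (hS i j)).mul (hS a b)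
  -- Coordinate lines suffice: the sum of the pure second derivatives replaces the Laplacian.
  -- Expanded below, it is the sum on the right of the algebraic inequality, so that sum can be
  -- discarded.
  have hlap := Finset.sum_nonpos fun m (_ : m ∈ (Finset.univ : Finset (Fin n))) =>
    pderiv_pderiv_nonpos_of_isLocalMax hU hsum hy hmax m
  have hpd : ∀ a b i j, pderiv a (pderiv b (S i j)) y = -pderiv a (pderiv b (S j i)) y := by
    intro a b i j
    have e : ∀ {f g : EuclideanSpace ℝ (Fin n) → ℝ}, EqOn f (fun z => (-1 : ℝ) * g z) U →
        ContDiffOn ℝ ∞ g U → ∀ c, EqOn (pderiv c f) (fun z => (-1 : ℝ) * pderiv c g z) U :=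
      fun hfg hg c z hz => (pderiv_congr hU hfg hz c).trans
        (pderiv_const_mul (differentiableAt_of_contDiffOn hU hg hz) _ _)
    have := e (e (f := S i j) (fun z hz => by simp only [hanti z hz i j, neg_one_mul]) (hS j i) b)
      (contDiffOn_pderiv hU b (hS j i)) a hy
    simpa using this
  have hcl : ∀ k i j, pderiv k (pderiv k (S i j)) y - pderiv k (pderiv i (S k j)) y
      + pderiv k (pderiv j (S k i)) y = 0 := by
    intro k i j
    have h := pderiv_congr hU (g := fun _ => 0) (fun z hz => hclosed z hz k i j) hy k
    have hd a b c := differentiableAt_of_contDiffOn hU (contDiffOn_pderiv hU a (hS b c)) hy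
    rwa [pderiv_const, pderiv_add ((hd k i j).fun_sub (hd i k j)) (hd j k i),
      pderiv_sub (hd k i j) (hd i k j)] at h
  have hτ' : ∀ i j, τ i j = -∑ k, (pderiv i (pderiv k (S j k)) y
      - ∑ p, pderiv i (christoffel G p k j) y * S p k y
      - ∑ p, pderiv i (christoffel G p k k) y * S j p y) := by
    intro i j
    have hsm : ContDiffOn ℝ ∞ (fun z => ∑ k, ∑ l, (G z)⁻¹ k l * covDeriv₂ G S k j l z) U :=
      ContDiffOn.sum fun k _ => ContDiffOn.sum fun l _ => (hG.contDiffOn_inv k l).mul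
        (((contDiffOn_pderiv hU k (hS j l)).sub
          (ContDiffOn.sum fun p _ => hG.contDiffOn_christoffel_mul (hS p l) p k j)).sub
          (ContDiffOn.sum fun p _ => hG.contDiffOn_christoffel_mul (hS j p) p k l))
    rw [hτ, ← hG.pderiv_divergence₂ hS]
    have := pderiv_const_mul (differentiableAt_of_contDiffOn hU hsm hy) (-1) i
    simpa using this
  rw [hG.inv_eq_one, normSq₄_one] at hK
  rw [hG.inv_eq_one, normSq₂_one]
  have key := evolution_inequality₂ (F₁ := fun m i j => pderiv m (S i j) y) (r := r)
    (F₂ := fun a b i j => pderiv a (pderiv b (S i j)) y)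
    (fun i j => hanti y hy i j) hpd (fun a b i j => pderiv_comm hU (hS i j) hy a b)
    hcl (fun i p j k => hG.pderiv_christoffel_symm i p j k)
    hG.pderiv_christoffel_add hG.riemann_eq hK hτ' (fun i j => rfl) hr
  simp only [pderiv_pderiv_normSq₂ hU hy hG.contDiffOn_inv hG.inv_eq_one _ (hG.pderiv_inv _) hS
    (fun i j => hanti y hy i j), hG.pderiv_pderiv_inv, neg_mul, Finset.sum_neg_distrib, mul_neg,
    ← sub_eq_add_neg] at hlap
  simp only [hG.ricci_eq]
  linarith

/-- At a spatial maximum of `|S|²`, for a closed 3-form `S`, the reaction terms of the evolution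
equation of `|S|²` are bounded by the curvature. -/
theorem evolution_le_of_isLocalMax₃ (hG : IsNormalAt G U y)
    {S : Fin n → Fin n → Fin n → EuclideanSpace ℝ (Fin n) → ℝ}
    (hS : ∀ i j k, ContDiffOn ℝ ∞ (S i j k) U)
    (h₁ : ∀ z ∈ U, ∀ i j k, S i j k z = -S j i k z) (h₂ : ∀ z ∈ U, ∀ i j k, S i j k z = -S i k j z)
    (hclosed : ∀ z ∈ U, ∀ k i j m, pderiv k (S i j m) z - pderiv i (S k j m) z
      + pderiv j (S k i m) z - pderiv m (S k i j) z = 0)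
    {K : ℝ} (hK : √(normSq₄ (G y)⁻¹ fun i j k l => riemann G i j k l y) ≤ K)
    (hmax : IsLocalMax (fun z => normSq₃ (G z)⁻¹ fun i j k => S i j k z) y)
    {τ : Fin n → Fin n → Fin n → ℝ} {r : Fin n → Fin n → ℝ}
    (hτ : ∀ i j m, τ i j m =
      pderiv i (fun z => ∑ k, ∑ l, (G z)⁻¹ k l * covDeriv₃ G S k l j m z) y)
    (hr : 0 ≤ ∑ i, ∑ j, r i j * ∑ k, ∑ l, S i k l y * S j k l y) :
    2 * ∑ i, ∑ j, ∑ k, S i j k y * (τ i j k - τ j i k + τ k i j)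
        - 3 * ∑ i, ∑ j, (-2 * ricci G i j y + r i j) * ∑ k, ∑ l, S i k l y * S j k l y ≤
      6 * K * normSq₃ (G y)⁻¹ fun i j k => S i j k y := by
  have hU := hG.isOpen
  have hy := hG.mem
  have hsum : ContDiffOn ℝ ∞ (fun z => normSq₃ (G z)⁻¹ fun i j k => S i j k z) U :=
    ContDiffOn.sum fun i _ => ContDiffOn.sum fun j _ => ContDiffOn.sum fun k _ =>
      ContDiffOn.sum fun a _ => ContDiffOn.sum fun b _ => ContDiffOn.sum fun c _ =>
        ((((hG.contDiffOn_inv i a).mul (hG.contDiffOn_inv j b)).mul (hG.contDiffOn_inv k c)).mul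
          (hS i j k)).mul (hS a b c)
  have hlap := Finset.sum_nonpos fun m (_ : m ∈ (Finset.univ : Finset (Fin n))) =>
    pderiv_pderiv_nonpos_of_isLocalMax hU hsum hy hmax m
  have hcl : ∀ k i j m, pderiv k (pderiv k (S i j m)) y - pderiv k (pderiv i (S k j m)) y
      + pderiv k (pderiv j (S k i m)) y - pderiv k (pderiv m (S k i j)) y = 0 := by
    intro k i j m
    have h := pderiv_congr hU (g := fun _ => 0) (fun z hz => hclosed z hz k i j m) hy k
    have hd a b c d := differentiableAt_of_contDiffOn hU (contDiffOn_pderiv hU a (hS b c d)) hy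
    rwa [pderiv_const,
      pderiv_sub (((hd k i j m).fun_sub (hd i k j m)).fun_add (hd j k i m)) (hd m k i j),
      pderiv_add ((hd k i j m).fun_sub (hd i k j m)) (hd j k i m),
      pderiv_sub (hd k i j m) (hd i k j m)] at h
  have hτ' i j m := (hτ i j m).trans (hG.pderiv_divergence₃ hS i j m)
  rw [hG.inv_eq_one, normSq₄_one] at hK
  rw [hG.inv_eq_one, normSq₃_one]
  have key := evolution_inequality₃ (H₁ := fun m i j k => pderiv m (S i j k) y) (r := r)
    (H₂ := fun a b i j k => pderiv a (pderiv b (S i j k)) y)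
    (h₁ y hy) (h₂ y hy) (fun a b i j k => pderiv_comm hU (hS i j k) hy a b)
    hcl (fun i p j k => hG.pderiv_christoffel_symm i p j k)
    hG.pderiv_christoffel_add hG.riemann_eq hK hτ' (fun i j => rfl) hr
  simp only [pderiv_pderiv_normSq₃ hU hy hG.contDiffOn_inv hG.inv_eq_one _ (hG.pderiv_inv _) hS
    (h₁ y hy) (h₂ y hy), hG.pderiv_pderiv_inv, neg_mul, Finset.sum_neg_distrib, mul_neg,
    ← sub_eq_add_neg] at hlap
  simp only [hG.ricci_eq]
  linarith

end IsNormalAt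

/-! ### Invariance of tensor norms under linear changes of coordinates -/

section Pullback

variable {n : ℕ}

/-- Both indices of `w` are transformed by `J`. -/
def pull (J : Matrix (Fin n) (Fin n) ℝ) (w : Fin n → Fin n → ℝ) (i a : Fin n) : ℝ :=
  ∑ p, ∑ s, J p i * J s a * w p s

/-- The two indices of `w` are contracted with `g`. -/
def contract (g : Matrix (Fin n) (Fin n) ℝ) (w : Fin n → Fin n → ℝ) : ℝ :=
  ∑ i, ∑ a, g i a * w i a

/-- Transforming covariant indices by `J` is dual to transforming the contravariant `g`. Norms are
iterated contractions, so this one-pair statement serves both degrees of forms. -/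
theorem contract_pull (J g : Matrix (Fin n) (Fin n) ℝ) (w : Fin n → Fin n → ℝ) :
    contract g (pull J w) = contract (J * g * J.transpose) w := by
  have h : ∀ p s, (J * g * J.transpose) p s = ∑ i, ∑ a, J p i * g i a * J s a := by
    intro p s
    simp only [Matrix.mul_apply, Matrix.transpose_apply, Finset.sum_mul]
    exact Finset.sum_comm
  simp only [contract, pull, h, Finset.mul_sum, Finset.sum_mul]
  refine (Finset.sum_congr rfl fun i _ => Finset.sum_comm.trans
    (Finset.sum_congr rfl fun p _ => Finset.sum_comm)).trans (Finset.sum_comm.trans ?_)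
  refine Finset.sum_congr rfl fun p _ => Finset.sum_comm.trans ?_
  exact Finset.sum_congr rfl fun s _ => Finset.sum_congr rfl fun i _ =>
    Finset.sum_congr rfl fun a _ => by ring

/-- Moves the transformation of an outer index pair through an inner contraction, so that
`contract_pull` can be applied to one pair at a time. -/
theorem contract_pull_comm (J g : Matrix (Fin n) (Fin n) ℝ)
    (W : Fin n → Fin n → Fin n → Fin n → ℝ) (i a : Fin n) :
    contract g (fun k c => pull J (fun p s => W p s k c) i a) =
      pull J (fun p s => contract g (W p s)) i a := by
  simp only [contract, pull, Finset.mul_sum]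
  rw [Finset.sum_congr rfl fun k _ => Finset.sum_comm, Finset.sum_comm]
  refine Finset.sum_congr rfl fun p _ => ?_
  rw [Finset.sum_congr rfl fun k _ => Finset.sum_comm, Finset.sum_comm]
  exact Finset.sum_congr rfl fun s _ => Finset.sum_congr rfl fun i _ =>
    Finset.sum_congr rfl fun a _ => by ring

theorem sum_mul_sum_eq_pull (J : Matrix (Fin n) (Fin n) ℝ) (X Y : Fin n → ℝ) (i a : Fin n) :
    (∑ p, J p i * X p) * (∑ s, J s a * Y s) = pull J (fun p s => X p * Y s) i a := by
  rw [Finset.sum_mul_sum, pull]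
  exact Finset.sum_congr rfl fun p _ => Finset.sum_congr rfl fun s _ => by ring

theorem normSq₂_eq_contract (g : Matrix (Fin n) (Fin n) ℝ) (S : Fin n → Fin n → ℝ) :
    normSq₂ g S = contract g fun i a => contract g fun j b => S i j * S a b := by
  simp only [normSq₂, contract, Finset.mul_sum]
  refine Finset.sum_congr rfl fun i _ => ?_
  rw [Finset.sum_comm]
  exact Finset.sum_congr rfl fun a _ => Finset.sum_congr rfl fun j _ =>
    Finset.sum_congr rfl fun b _ => by ring

theorem normSq₃_eq_contract (g : Matrix (Fin n) (Fin n) ℝ) (S : Fin n → Fin n → Fin n → ℝ) :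
    normSq₃ g S =
      contract g fun i a => contract g fun j b => contract g fun k c => S i j k * S a b c := by
  simp only [normSq₃, contract, Finset.mul_sum]
  refine Finset.sum_congr rfl fun i _ => ?_
  rw [Finset.sum_congr rfl fun j _ => Finset.sum_comm, Finset.sum_comm]
  refine Finset.sum_congr rfl fun a _ => Finset.sum_congr rfl fun j _ => ?_
  rw [Finset.sum_comm]
  exact Finset.sum_congr rfl fun b _ => Finset.sum_congr rfl fun k _ =>
    Finset.sum_congr rfl fun c _ => by ring

theorem normSq₂_pull (J g : Matrix (Fin n) (Fin n) ℝ) (S : Fin n → Fin n → ℝ) :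
    normSq₂ g (fun i j => ∑ p, J p i * ∑ q, J q j * S p q) =
      normSq₂ (J * g * J.transpose) S := by
  simp only [normSq₂_eq_contract, sum_mul_sum_eq_pull, contract_pull_comm, contract_pull]

theorem normSq₃_pull (J g : Matrix (Fin n) (Fin n) ℝ) (S : Fin n → Fin n → Fin n → ℝ) :
    normSq₃ g (fun i j k => ∑ p, J p i * ∑ q, J q j * ∑ r, J r k * S p q r) =
      normSq₃ (J * g * J.transpose) S := by
  simp only [normSq₃_eq_contract, sum_mul_sum_eq_pull, contract_pull_comm, contract_pull]

/-- Nondegeneracy of the transformed metric already forces `J` to be invertible. -/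
theorem mul_inv_mul_transpose {J G : Matrix (Fin n) (Fin n) ℝ}
    (h : (J.transpose * G * J).det ≠ 0) :
    J * (J.transpose * G * J)⁻¹ * J.transpose = G⁻¹ := by
  have hJ : J.det ≠ 0 := fun h0 => h (by simp [h0])
  have hJ' : IsUnit J.det := isUnit_iff_ne_zero.2 hJ
  have hJt : IsUnit J.transpose.det := by rwa [Matrix.det_transpose]
  rw [Matrix.mul_inv_rev, Matrix.mul_inv_rev, ← Matrix.mul_assoc, ← Matrix.mul_assoc,
    Matrix.mul_nonsing_inv _ hJ', Matrix.one_mul, Matrix.mul_assoc, Matrix.nonsing_inv_mul _ hJt,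
    Matrix.mul_one]

end Pullback

/-! ### Change of charts for metrics and forms -/

section Charts

variable {n : ℕ} {M : Type*} [TopologicalSpace M] [ChartedSpace (EuclideanSpace ℝ (Fin n)) M]
  {e e' : OpenPartialHomeomorph M (EuclideanSpace ℝ (Fin n))}
  {y z : EuclideanSpace ℝ (Fin n)}

/-- The Jacobian matrix of a map between Euclidean spaces. -/
def jacobian (Φ : EuclideanSpace ℝ (Fin n) → EuclideanSpace ℝ (Fin n))
    (z : EuclideanSpace ℝ (Fin n)) : Matrix (Fin n) (Fin n) ℝ :=
  Matrix.of fun a i => fderiv ℝ Φ z (EuclideanSpace.single i 1) a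

theorem fderiv_single_eq_sum (Φ : EuclideanSpace ℝ (Fin n) → EuclideanSpace ℝ (Fin n))
    (z : EuclideanSpace ℝ (Fin n)) (i : Fin n) :
    fderiv ℝ Φ z (EuclideanSpace.single i 1) =
      ∑ a, jacobian Φ z a i • EuclideanSpace.single a (1 : ℝ) := by
  ext b
  simp [jacobian, Pi.single_apply]

/-- `Φ` is the coordinate expression near `z` of the change from the chart `e'` to `e`. -/
structure IsTransitionAt (e e' : OpenPartialHomeomorph M (EuclideanSpace ℝ (Fin n)))
    (Φ : EuclideanSpace ℝ (Fin n) → EuclideanSpace ℝ (Fin n))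
    (z : EuclideanSpace ℝ (Fin n)) : Prop where
  mem_target : Φ z ∈ e.target
  differentiableAt : DifferentiableAt ℝ Φ z
  symm_eq : e'.symm =ᶠ[𝓝 z] fun w => e.symm (Φ w)

theorem isTransitionAt_comp_symm (he : e ∈ IsManifold.maximalAtlas (𝓡 n) ∞ M)
    (he' : e' ∈ IsManifold.maximalAtlas (𝓡 n) ∞ M) (hz : z ∈ e'.target)
    (hze : e'.symm z ∈ e.source) : IsTransitionAt e e' (fun w => e (e'.symm w)) z where
  mem_target := e.map_source hze
  differentiableAt := by
    have h : ContMDiffAt (𝓡 n) (𝓡 n) ∞ (e ∘ e'.symm) z :=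
      (contMDiffAt_of_mem_maximalAtlas he hze).comp z (contMDiffAt_symm_of_mem_maximalAtlas he' hz)
    exact (contMDiffAt_iff_contDiffAt.1 h).differentiableAt (by simp)
  symm_eq := by
    have h := (e'.continuousAt_symm hz).eventually (e.open_source.mem_nhds hze)
    filter_upwards [h] with w hw using (e.left_inv hw).symm

namespace IsTransitionAt

variable {Φ : EuclideanSpace ℝ (Fin n) → EuclideanSpace ℝ (Fin n)}

theorem chartDeriv_apply (h : IsTransitionAt e e' Φ z)
    (he : e ∈ IsManifold.maximalAtlas (𝓡 n) ∞ M) (v : EuclideanSpace ℝ (Fin n)) :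
    (chartDeriv e' z v : EuclideanSpace ℝ (Fin n)) = chartDeriv e (Φ z) (fderiv ℝ Φ z v) := by
  have h₁ : mfderiv (𝓡 n) (𝓡 n) e'.symm z = mfderiv (𝓡 n) (𝓡 n) (e.symm ∘ Φ) z :=
    h.symm_eq.mfderiv_eq
  have h₂ := mfderiv_comp z (I := 𝓡 n) (I' := 𝓡 n) (I'' := 𝓡 n) (g := e.symm) (f := Φ)
    ((contMDiffAt_symm_of_mem_maximalAtlas he h.mem_target).mdifferentiableAt (by simp))
    h.differentiableAt.mdifferentiableAt
  rw [mfderiv_eq_fderiv] at h₂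
  unfold chartDeriv
  rw [h₁, h₂]
  rfl

/-- All tangent spaces unfold to the same model space, so the base point can be replaced by an equal
one while the vectors stay fixed. This is needed because `e'.symm z` and `e.symm (Φ z)` are equal
but not definitionally. -/
theorem inner_eq [IsManifold (𝓡 n) ∞ M] {p q : M} (hpq : p = q) (g : Metric n M) (v w : EuclideanSpace ℝ (Fin n)) :
    g.inner p v w = g.inner q v w := by
  subst hpq
  rfl

theorem form_eq {k : ℕ} {p q : M} (hpq : p = q) (α : Form n M k)
    (v : Fin k → EuclideanSpace ℝ (Fin n)) :
    (α p) v = (α q) v := by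
  subst hpq
  rfl

theorem metricIn_eq [IsManifold (𝓡 n) ∞ M] (h : IsTransitionAt e e' Φ z)
    (he : e ∈ IsManifold.maximalAtlas (𝓡 n) ∞ M) (g : Metric n M) :
    metricIn e' g z = (jacobian Φ z).transpose * metricIn e g (Φ z) * jacobian Φ z := by
  ext i j
  have h₁ : metricIn e' g z i j = g.inner (e.symm (Φ z))
      (chartDeriv e (Φ z) (fderiv ℝ Φ z (EuclideanSpace.single i 1)))
      (chartDeriv e (Φ z) (fderiv ℝ Φ z (EuclideanSpace.single j 1))) := by
    rw [← h.chartDeriv_apply he, ← h.chartDeriv_apply he]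
    exact inner_eq h.symm_eq.eq_of_nhds g _ _
  rw [h₁, fderiv_single_eq_sum, fderiv_single_eq_sum]
  simp only [map_sum, map_smul, _root_.sum_apply, _root_.smul_apply,
    smul_eq_mul, Matrix.mul_apply, Matrix.transpose_apply, Finset.sum_mul, Finset.mul_sum]
  refine Finset.sum_congr rfl fun a _ => Finset.sum_congr rfl fun b _ => ?_
  simp only [metricIn, Matrix.of_apply]
  ring

theorem formIn_apply {k : ℕ} (h : IsTransitionAt e e' Φ z)
    (he : e ∈ IsManifold.maximalAtlas (𝓡 n) ∞ M) (α : Form n M k)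
    (v : Fin k → EuclideanSpace ℝ (Fin n)) :
    formIn e' α z v = formIn e α (Φ z) (fun i => fderiv ℝ Φ z (v i)) := by
  have h₁ : (fun i => (chartDeriv e' z (v i) : EuclideanSpace ℝ (Fin n))) =
      fun i => chartDeriv e (Φ z) (fderiv ℝ Φ z (v i)) :=
    funext fun i => h.chartDeriv_apply he _
  change (α (e'.symm z)) (fun i => chartDeriv e' z (v i)) =
    (α (e.symm (Φ z))) (fun i => chartDeriv e (Φ z) (fderiv ℝ Φ z (v i)))
  exact (congrArg (α (e'.symm z)) h₁).trans (form_eq h.symm_eq.eq_of_nhds α _)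

end IsTransitionAt

/-- Currying reduces multilinearity to linearity in the first slot; repeating this on the curried
map expands the later slots. -/
theorem multilinear_cons_sum {k : ℕ}
    (f : MultilinearMap ℝ (fun _ : Fin (k + 1) => EuclideanSpace ℝ (Fin n)) ℝ) (x : Fin n → ℝ)
    (v : Fin k → EuclideanSpace ℝ (Fin n)) :
    f (Fin.cons (∑ a, x a • EuclideanSpace.single a 1) v) =
      ∑ a, x a * f (Fin.cons (EuclideanSpace.single a 1) v) := by
  have h : ∀ w, f (Fin.cons w v) = f.curryLeft w v := fun _ => rfl
  simp only [h, map_sum, map_smul, _root_.sum_apply, _root_.smul_apply, smul_eq_mul]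

theorem alternating_apply_sum₂ (f : (EuclideanSpace ℝ (Fin n)) [⋀^Fin 2]→L[ℝ] ℝ)
    (x y : Fin n → ℝ) :
    f ![∑ a, x a • EuclideanSpace.single a 1, ∑ b, y b • EuclideanSpace.single b 1] =
      ∑ a, x a * ∑ b, y b * f ![EuclideanSpace.single a 1, EuclideanSpace.single b 1] := by
  refine (multilinear_cons_sum f.toMultilinearMap x _).trans
    (Finset.sum_congr rfl fun a _ => congrArg (x a * ·) ?_)
  exact multilinear_cons_sum (f.toMultilinearMap.curryLeft (EuclideanSpace.single a 1)) y _

theorem alternating_apply_sum₃ (f : (EuclideanSpace ℝ (Fin n)) [⋀^Fin 3]→L[ℝ] ℝ)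
    (x y z : Fin n → ℝ) :
    f ![∑ a, x a • EuclideanSpace.single a 1, ∑ b, y b • EuclideanSpace.single b 1,
        ∑ c, z c • EuclideanSpace.single c 1] =
      ∑ a, x a * ∑ b, y b * ∑ c, z c * f ![EuclideanSpace.single a 1, EuclideanSpace.single b 1,
        EuclideanSpace.single c 1] := by
  refine (multilinear_cons_sum f.toMultilinearMap x _).trans
    (Finset.sum_congr rfl fun a _ => congrArg (x a * ·) ?_)
  refine (multilinear_cons_sum (f.toMultilinearMap.curryLeft (EuclideanSpace.single a 1)) y
    _).trans (Finset.sum_congr rfl fun b _ => congrArg (y b * ·) ?_)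
  exact multilinear_cons_sum ((f.toMultilinearMap.curryLeft
    (EuclideanSpace.single a 1)).curryLeft (EuclideanSpace.single b 1)) z _

namespace IsTransitionAt

variable {Φ : EuclideanSpace ℝ (Fin n) → EuclideanSpace ℝ (Fin n)}

theorem comp₂_eq (h : IsTransitionAt e e' Φ z) (he : e ∈ IsManifold.maximalAtlas (𝓡 n) ∞ M)
    (α : Form n M 2) (i j : Fin n) :
    comp₂ e' α i j z =
      ∑ p, jacobian Φ z p i * ∑ q, jacobian Φ z q j * comp₂ e α p q (Φ z) := by
  unfold comp₂
  rw [h.formIn_apply he, ← alternating_apply_sum₂, ← fderiv_single_eq_sum, ← fderiv_single_eq_sum]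
  congr 1
  ext a : 1
  fin_cases a <;> rfl

theorem comp₃_eq (h : IsTransitionAt e e' Φ z) (he : e ∈ IsManifold.maximalAtlas (𝓡 n) ∞ M)
    (α : Form n M 3) (i j k : Fin n) :
    comp₃ e' α i j k z = ∑ p, jacobian Φ z p i * ∑ q, jacobian Φ z q j *
      ∑ r, jacobian Φ z r k * comp₃ e α p q r (Φ z) := by
  unfold comp₃
  rw [h.formIn_apply he, ← alternating_apply_sum₃, ← fderiv_single_eq_sum, ← fderiv_single_eq_sum,
    ← fderiv_single_eq_sum]
  congr 1
  ext a : 1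
  fin_cases a <;> rfl

end IsTransitionAt

theorem mdifferentiable_of_mem_maximalAtlas (he : e ∈ IsManifold.maximalAtlas (𝓡 n) ∞ M) :
    e.MDifferentiable (𝓡 n) (𝓡 n) :=
  ⟨(contMDiffOn_of_mem_maximalAtlas he).mdifferentiableOn (by simp),
    (contMDiffOn_symm_of_mem_maximalAtlas he).mdifferentiableOn (by simp)⟩

section Metric

variable [IsManifold (𝓡 n) ∞ M]

theorem metricIn_symm (e : OpenPartialHomeomorph M (EuclideanSpace ℝ (Fin n))) (g : Metric n M)
    (y : EuclideanSpace ℝ (Fin n)) (i j : Fin n) : metricIn e g y i j = metricIn e g y j i :=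
  g.symm _ _ _

theorem posDef_metricIn (he : e ∈ IsManifold.maximalAtlas (𝓡 n) ∞ M) (g : Metric n M)
    (hy : y ∈ e.target) : (metricIn e g y).PosDef := by
  refine Matrix.PosDef.of_dotProduct_mulVec_pos (Matrix.IsHermitian.ext fun i j => ?_)
    fun x hx => ?_
  · exact metricIn_symm e g y j i
  set v : EuclideanSpace ℝ (Fin n) := ∑ a, x a • EuclideanSpace.single a (1 : ℝ) with hv
  have hvx : ∀ b, v b = x b := fun b => by simp [hv, Pi.single_apply]
  have hv0 : v ≠ 0 := fun h0 => hx (funext fun b => by rw [← hvx, h0]; rfl)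
  have hinj : Function.Injective (chartDeriv e y) :=
    (mdifferentiable_of_mem_maximalAtlas he).symm.mfderiv_injective hy
  have hpos := g.pos (e.symm y) (chartDeriv e y v) fun h0 => hv0 (hinj (h0.trans (map_zero _).symm))
  have heq : g.inner (e.symm y) (chartDeriv e y v) (chartDeriv e y v) =
      star x ⬝ᵥ (metricIn e g y).mulVec x := by
    simp only [hv, map_sum, map_smul, _root_.sum_apply, _root_.smul_apply, smul_eq_mul,
      dotProduct, Matrix.mulVec, Finset.mul_sum, star_trivial]
    rw [Finset.sum_comm]
    refine Finset.sum_congr rfl fun a _ => Finset.sum_congr rfl fun b _ => ?_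
    simp only [metricIn, Matrix.of_apply]
    ring
  rwa [← heq]

theorem det_metricIn_ne_zero (he : e ∈ IsManifold.maximalAtlas (𝓡 n) ∞ M) (g : Metric n M)
    (hy : y ∈ e.target) : (metricIn e g y).det ≠ 0 :=
  (posDef_metricIn he g hy).det_pos.ne'

theorem IsTransitionAt.normSq₂_eq {Φ : EuclideanSpace ℝ (Fin n) → EuclideanSpace ℝ (Fin n)}
    (h : IsTransitionAt e e' Φ z) (he : e ∈ IsManifold.maximalAtlas (𝓡 n) ∞ M)
    (he' : e' ∈ IsManifold.maximalAtlas (𝓡 n) ∞ M) (hz : z ∈ e'.target) (g : Metric n M)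
    (α : Form n M 2) :
    (normSq₂ (metricIn e' g z)⁻¹ fun i j => comp₂ e' α i j z) =
      normSq₂ (metricIn e g (Φ z))⁻¹ fun i j => comp₂ e α i j (Φ z) := by
  have hdet := det_metricIn_ne_zero he' g hz
  rw [h.metricIn_eq he] at hdet ⊢
  simp only [h.comp₂_eq he]
  rw [normSq₂_pull, mul_inv_mul_transpose hdet]

theorem IsTransitionAt.normSq₃_eq {Φ : EuclideanSpace ℝ (Fin n) → EuclideanSpace ℝ (Fin n)}
    (h : IsTransitionAt e e' Φ z) (he : e ∈ IsManifold.maximalAtlas (𝓡 n) ∞ M)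
    (he' : e' ∈ IsManifold.maximalAtlas (𝓡 n) ∞ M) (hz : z ∈ e'.target) (g : Metric n M)
    (α : Form n M 3) :
    (normSq₃ (metricIn e' g z)⁻¹ fun i j k => comp₃ e' α i j k z) =
      normSq₃ (metricIn e g (Φ z))⁻¹ fun i j k => comp₃ e α i j k (Φ z) := by
  have hdet := det_metricIn_ne_zero he' g hz
  rw [h.metricIn_eq he] at hdet ⊢
  simp only [h.comp₃_eq he]
  rw [normSq₃_pull, mul_inv_mul_transpose hdet]

/-- The squared norm of a 2-form does not depend on the chart. -/
theorem normSq₂_chart_eq (he : e ∈ IsManifold.maximalAtlas (𝓡 n) ∞ M)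
    (he' : e' ∈ IsManifold.maximalAtlas (𝓡 n) ∞ M) {x : M} (hx : x ∈ e.source) (hx' : x ∈ e'.source)
    (g : Metric n M) (α : Form n M 2) :
    (normSq₂ (metricIn e' g (e' x))⁻¹ fun i j => comp₂ e' α i j (e' x)) =
      normSq₂ (metricIn e g (e x))⁻¹ fun i j => comp₂ e α i j (e x) := by
  have h := isTransitionAt_comp_symm he he' (e'.map_source hx') (by rwa [e'.left_inv hx'])
  have := h.normSq₂_eq he he' (e'.map_source hx') g α
  rwa [e'.left_inv hx'] at this

/-- The squared norm of a 3-form does not depend on the chart. -/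
theorem normSq₃_chart_eq (he : e ∈ IsManifold.maximalAtlas (𝓡 n) ∞ M)
    (he' : e' ∈ IsManifold.maximalAtlas (𝓡 n) ∞ M) {x : M} (hx : x ∈ e.source) (hx' : x ∈ e'.source)
    (g : Metric n M) (α : Form n M 3) :
    (normSq₃ (metricIn e' g (e' x))⁻¹ fun i j k => comp₃ e' α i j k (e' x)) =
      normSq₃ (metricIn e g (e x))⁻¹ fun i j k => comp₃ e α i j k (e x) := by
  have h := isTransitionAt_comp_symm he he' (e'.map_source hx') (by rwa [e'.left_inv hx'])
  have := h.normSq₃_eq he he' (e'.map_source hx') g α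
  rwa [e'.left_inv hx'] at this

end Metric

end Charts

/-! ### Existence of charts in which the metric is the identity to first order -/

section NormalChart

/-- Diagonalise `G` orthogonally and rescale each eigenvector by the inverse square root of its
eigenvalue. -/
theorem exists_transpose_mul_mul_eq_one {ι : Type*} [Fintype ι] [DecidableEq ι]
    {G : Matrix ι ι ℝ} (hG : G.PosDef) : ∃ L : Matrix ι ι ℝ, L.transpose * G * L = 1 := by
  set W : Matrix ι ι ℝ := (hG.1.eigenvectorUnitary : Matrix ι ι ℝ) with hW
  set D : Matrix ι ι ℝ := Matrix.diagonal fun i => (√(hG.1.eigenvalues i))⁻¹ with hD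
  have hWW : W.transpose * W = 1 := by
    have := Matrix.mem_unitaryGroup_iff'.1 hG.1.eigenvectorUnitary.2
    simpa [Matrix.star_eq_conjTranspose, Matrix.conjTranspose_eq_transpose_of_trivial] using this
  have hspec : G = W * Matrix.diagonal hG.1.eigenvalues * W.transpose := by
    have := hG.1.spectral_theorem
    rw [Unitary.conjStarAlgAut_apply] at this
    simpa [Matrix.star_eq_conjTranspose, Matrix.conjTranspose_eq_transpose_of_trivial,
      Function.comp_def] using this
  refine ⟨W * D, ?_⟩
  have hdiag : D * Matrix.diagonal hG.1.eigenvalues * D = 1 := by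
    simp only [hD, Matrix.diagonal_mul_diagonal]
    rw [← Matrix.diagonal_one]
    congr 1
    ext i
    have hp := hG.eigenvalues_pos i
    have hs := Real.sqrt_pos.2 hp
    field_simp
    exact (Real.sq_sqrt hp.le).symm
  have hDt : D.transpose = D := Matrix.diagonal_transpose _
  calc (W * D).transpose * G * (W * D)
      = D.transpose * (W.transpose * W) * Matrix.diagonal hG.1.eigenvalues
          * (W.transpose * W) * D := by
        conv_lhs => rw [hspec]
        rw [Matrix.transpose_mul]
        simp only [Matrix.mul_assoc]
    _ = 1 := by rw [hWW, hDt, Matrix.mul_one, Matrix.mul_one, hdiag]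

variable {n : ℕ} {Φ : EuclideanSpace ℝ (Fin n) → EuclideanSpace ℝ (Fin n)}
  {z : EuclideanSpace ℝ (Fin n)}

theorem exists_equiv_of_det_jacobian_ne_zero (h : (jacobian Φ z).det ≠ 0) :
    ∃ L : EuclideanSpace ℝ (Fin n) ≃L[ℝ] EuclideanSpace ℝ (Fin n),
      (L : EuclideanSpace ℝ (Fin n) →L[ℝ] EuclideanSpace ℝ (Fin n)) = fderiv ℝ Φ z := by
  have hmul : ∀ v : EuclideanSpace ℝ (Fin n), ∀ a,
      fderiv ℝ Φ z v a = (jacobian Φ z).mulVec (fun i => v i) a := by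
    intro v a
    have hv : v = ∑ i, v i • EuclideanSpace.single i (1 : ℝ) := by
      ext b; simp [Pi.single_apply]
    conv_lhs => rw [hv]
    simp [Matrix.mulVec, dotProduct, jacobian, mul_comm]
  have hinj : Function.Injective (fderiv ℝ Φ z) := by
    rw [injective_iff_map_eq_zero]
    intro v hv
    have : (jacobian Φ z).mulVec (fun i => v i) = 0 := by
      ext a
      rw [← hmul, hv]
      rfl
    have h0 := Matrix.eq_zero_of_mulVec_eq_zero h this
    ext i
    exact congrFun h0 i
  refine ⟨(LinearEquiv.ofInjectiveEndo (fderiv ℝ Φ z : EuclideanSpace ℝ (Fin n) →ₗ[ℝ] _)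
    hinj).toContinuousLinearEquiv, ?_⟩
  ext v
  rfl

theorem jacobian_apply (h : DifferentiableAt ℝ Φ z) (a i : Fin n) :
    jacobian Φ z a i = pderiv i (fun w => Φ w a) z := by
  have := ((EuclideanSpace.proj (𝕜 := ℝ) a).hasFDerivAt.comp z h.hasFDerivAt).fderiv
  simp only [pderiv, jacobian, Matrix.of_apply]
  change _ = fderiv ℝ (EuclideanSpace.proj (𝕜 := ℝ) a ∘ Φ) z _
  rw [this]
  rfl

variable {M : Type*} [TopologicalSpace M] [ChartedSpace (EuclideanSpace ℝ (Fin n)) M]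
  [IsManifold (𝓡 n) ∞ M] {e : OpenPartialHomeomorph M (EuclideanSpace ℝ (Fin n))}

/-- A chart can be changed by any local diffeomorphism of the Euclidean space. -/
theorem exists_chart_comp (he : e ∈ IsManifold.maximalAtlas (𝓡 n) ∞ M) {x : M} (hx : x ∈ e.source)
    (hΦ : ContDiff ℝ ∞ Φ) (hz : Φ z = e x) (hdet : (jacobian Φ z).det ≠ 0) :
    ∃ e' ∈ IsManifold.maximalAtlas (𝓡 n) ∞ M, x ∈ e'.source ∧ e' x = z ∧
      ∀ w ∈ e'.target, IsTransitionAt e e' Φ w := by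
  have hs : IsOpen {w | (jacobian Φ w).det ≠ 0} := by
    have hc : Continuous fun w => (jacobian Φ w).det := by
      refine Continuous.matrix_det (continuous_matrix fun a i => ?_)
      have : Continuous fun w => fderiv ℝ Φ w (EuclideanSpace.single i 1) :=
        (hΦ.continuous_fderiv (by simp)).clm_apply continuous_const
      exact (EuclideanSpace.proj (𝕜 := ℝ) a).continuous.comp this
    exact isOpen_ne_fun hc continuous_const
  obtain ⟨L, hL⟩ := exists_equiv_of_det_jacobian_ne_zero hdet
  have hd : HasFDerivAt Φ (L : EuclideanSpace ℝ (Fin n) →L[ℝ] EuclideanSpace ℝ (Fin n)) z :=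
    hL ▸ (hΦ.differentiable (by simp) z).hasFDerivAt
  set φ := (hΦ.contDiffAt (x := z)).toOpenPartialHomeomorph Φ hd (by simp) with hφ
  have hφz : z ∈ φ.source := ContDiffAt.mem_toOpenPartialHomeomorph_source _ hd (by simp)
  -- The inverse function theorem is applied at `z` only. Keeping just the points with nonzero
  -- Jacobian makes the inverse smooth on the whole of its domain, as a chart of the maximal atlas
  -- requires.
  set ψ := φ.restrOpen _ hs with hψ
  have hψc : ∀ w, ψ w = Φ w := fun _ => rfl
  have hψs : ψ.source = φ.source ∩ {w | (jacobian Φ w).det ≠ 0} := rfl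
  have hzψ : z ∈ ψ.source := ⟨hφz, hdet⟩
  have hsymm : ContDiffOn ℝ ∞ ψ.symm ψ.target := by
    intro w hw
    have hw' := ψ.map_target hw
    obtain ⟨L', hL'⟩ := exists_equiv_of_det_jacobian_ne_zero (hψs ▸ hw').2
    refine (ψ.contDiffAt_symm hw (f₀' := L') ?_ hΦ.contDiffAt).contDiffWithinAt
    rw [hL']
    exact (hΦ.differentiable (by simp) _).hasFDerivAt
  refine ⟨e.trans ψ.symm, ?_, ⟨hx, ?_⟩, ?_, ?_⟩
  · refine OpenPartialHomeomorph.mem_maximalAtlas_of_contMDiffOn _ ?_ ?_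
    · exact (contMDiffOn_iff_contDiffOn.2 hsymm).comp
        ((contMDiffOn_of_mem_maximalAtlas he).mono inter_subset_left) fun w hw => hw.2
    · exact (contMDiffOn_symm_of_mem_maximalAtlas he).comp
        (hΦ.contMDiff.contMDiffOn) fun w hw => hw.2
  · change e x ∈ ψ.target
    rw [← hz, ← hψc]
    exact ψ.map_source hzψ
  · change ψ.symm (e x) = z
    rw [← hz, ← hψc, ψ.left_inv hzψ]
  · intro w hw
    exact ⟨hw.2, hΦ.differentiable (by simp) w, Filter.EventuallyEq.rfl⟩

/-- Around each point there is a chart centred there in which the metric is the identity at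
the origin. -/
theorem exists_chart_metricIn_eq_one (he : e ∈ IsManifold.maximalAtlas (𝓡 n) ∞ M) {x : M}
    (hx : x ∈ e.source) (g : Metric n M) :
    ∃ e' ∈ IsManifold.maximalAtlas (𝓡 n) ∞ M, x ∈ e'.source ∧ e' x = 0 ∧
      metricIn e' g 0 = 1 := by
  obtain ⟨L, hL⟩ := exists_transpose_mul_mul_eq_one (posDef_metricIn he g (e.map_source hx))
  set Φ : EuclideanSpace ℝ (Fin n) → EuclideanSpace ℝ (Fin n) :=
    fun w => e x + Matrix.toEuclideanCLM (𝕜 := ℝ) L w with hΦ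
  have hsm : ContDiff ℝ ∞ Φ :=
    contDiff_const.add (Matrix.toEuclideanCLM (𝕜 := ℝ) L).contDiff
  have hJ : jacobian Φ 0 = L := by
    have hf : fderiv ℝ Φ 0 = Matrix.toEuclideanCLM (𝕜 := ℝ) L := by
      simp only [hΦ]
      rw [fderiv_const_add, ContinuousLinearMap.fderiv]
    ext a i
    simp [jacobian, hf]
  have h0 : Φ 0 = e x := by simp [hΦ]
  have hdet : (jacobian Φ 0).det ≠ 0 := by
    rw [hJ]
    intro h
    have := congrArg Matrix.det hL
    simp [h] at this
  obtain ⟨e', he', hx', hex, htr⟩ := exists_chart_comp he hx hsm h0 hdet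
  refine ⟨e', he', hx', hex, ?_⟩
  rw [(htr 0 (hex ▸ e'.map_source hx')).metricIn_eq he, hJ, h0, hL]

/-- The quadratic change of coordinates `w^k ↦ w^k - ½ c^k_{ij} w^i w^j`. -/
def quadraticMap (c : Fin n → Fin n → Fin n → ℝ) (w : EuclideanSpace ℝ (Fin n)) :
    EuclideanSpace ℝ (Fin n) :=
  WithLp.toLp 2 fun k => w k - ∑ i, ∑ j, (1 / 2 * c k i j) * (w i * w j)

theorem contDiff_quadraticMap (c : Fin n → Fin n → Fin n → ℝ) : ContDiff ℝ ∞ (quadraticMap c) := by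
  unfold quadraticMap
  fun_prop

theorem pderiv_coord (m i : Fin n) :
    pderiv m (fun w : EuclideanSpace ℝ (Fin n) => w i) z = (1 : Matrix (Fin n) (Fin n) ℝ) i m := by
  have : fderiv ℝ (fun w : EuclideanSpace ℝ (Fin n) => w i) z = EuclideanSpace.proj (𝕜 := ℝ) i :=
    (EuclideanSpace.proj (𝕜 := ℝ) i).fderiv
  simp [pderiv, this, Matrix.one_apply]

theorem differentiableAt_coord (i : Fin n) :
    DifferentiableAt ℝ (fun w : EuclideanSpace ℝ (Fin n) => w i) z :=
  (EuclideanSpace.proj (𝕜 := ℝ) i).differentiableAt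

theorem jacobian_quadraticMap {c : Fin n → Fin n → Fin n → ℝ} (hc : ∀ k i j, c k i j = c k j i)
    (a i : Fin n) : jacobian (quadraticMap c) z a i =
      (1 : Matrix (Fin n) (Fin n) ℝ) a i - ∑ j, c a i j * z j := by
  have hd : ∀ i, DifferentiableAt ℝ (fun w : EuclideanSpace ℝ (Fin n) => w i) z :=
    differentiableAt_coord
  rw [jacobian_apply ((contDiff_quadraticMap c).differentiable (by simp) z)]
  simp only [quadraticMap]
  rw [pderiv_sub (hd a) (by fun_prop), pderiv_coord, pderiv_sum fun _ _ => by fun_prop]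
  congr 1
  have h : ∀ k l, pderiv i (fun w : EuclideanSpace ℝ (Fin n) => 1 / 2 * c a k l * (w k * w l)) z =
      1 / 2 * c a k l * ((1 : Matrix (Fin n) (Fin n) ℝ) k i * z l
        + z k * (1 : Matrix (Fin n) (Fin n) ℝ) l i) := by
    intro k l
    rw [pderiv_const_mul ((hd k).fun_mul (hd l)), pderiv_mul (hd k) (hd l), pderiv_coord, pderiv_coord]
  have h' : ∀ k, pderiv i (fun w : EuclideanSpace ℝ (Fin n) =>
      ∑ l, 1 / 2 * c a k l * (w k * w l)) z = ∑ l, 1 / 2 * c a k l *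
        ((1 : Matrix (Fin n) (Fin n) ℝ) k i * z l + z k * (1 : Matrix (Fin n) (Fin n) ℝ) l i) := by
    intro k
    rw [pderiv_sum fun l _ => ((hd k).fun_mul (hd l)).const_mul _]
    simp only [h]
  simp only [h', mul_add, Finset.sum_add_distrib, Matrix.one_apply, mul_ite, ite_mul, mul_one,
    one_mul, mul_zero, zero_mul, Finset.sum_ite_eq', Finset.mem_univ, if_true, Finset.sum_ite_irrel,
    Finset.sum_const_zero]
  rw [← Finset.sum_add_distrib]
  exact Finset.sum_congr rfl fun j _ => by rw [hc a j i]; ring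

/-- Around each point there is a chart in which the metric is the identity to first order. -/
theorem exists_isNormalAt (he : e ∈ IsManifold.maximalAtlas (𝓡 n) ∞ M) {x : M} (hx : x ∈ e.source)
    (g : Metric n M) (hg : ∀ e ∈ IsManifold.maximalAtlas (𝓡 n) ∞ M, ∀ i j : Fin n,
      ContDiffOn ℝ ∞ (fun w => metricIn e g w i j) e.target) :
    ∃ e' ∈ IsManifold.maximalAtlas (𝓡 n) ∞ M, x ∈ e'.source ∧
      IsNormalAt (metricIn e' g) e'.target (e' x) := by
  obtain ⟨e₁, he₁, hx₁, hex₁, hone⟩ := exists_chart_metricIn_eq_one he hx g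
  set D : Fin n → Fin n → Fin n → ℝ := fun m i j => pderiv m (fun w => metricIn e₁ g w i j) 0
    with hD
  have hDs : ∀ m i j, D m i j = D m j i := fun m i j => by
    simp only [hD, metricIn_symm e₁ g _ i j]
  -- These are the Christoffel symbols at the origin, the metric being the identity there. The
  -- quadratic map built from them has derivative the identity at 0 and removes the first
  -- derivatives of the metric.
  set c : Fin n → Fin n → Fin n → ℝ :=
    fun k i j => (1 / 2) * (D i j k + D j i k - D k i j) with hc
  have hcs : ∀ k i j, c k i j = c k j i := fun k i j => by
    simp only [hc, hDs k i j]; ring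
  have hΦ := contDiff_quadraticMap c
  have hΦ0 : quadraticMap c 0 = e₁ x := by
    rw [hex₁]; ext k; simp [quadraticMap]
  have hJ0 : jacobian (quadraticMap c) 0 = 1 := by
    ext a i
    rw [jacobian_quadraticMap hcs]
    simp
  obtain ⟨e', he', hx', hex, htr⟩ := exists_chart_comp he₁ hx₁ hΦ hΦ0 (by rw [hJ0]; simp)
  have h0t : (0 : EuclideanSpace ℝ (Fin n)) ∈ e'.target := hex ▸ e'.map_source hx'
  have hΦ0' : quadraticMap c 0 = 0 := hΦ0.trans hex₁
  have h0t₁ : (0 : EuclideanSpace ℝ (Fin n)) ∈ e₁.target := hex₁ ▸ e₁.map_source hx₁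
  refine ⟨e', he', hx', ?_⟩
  rw [hex]
  refine ⟨e'.open_target, h0t, hg e' he', fun w hw => det_metricIn_ne_zero he' g hw,
    fun w _ => metricIn_symm e' g w, ?_, ?_⟩
  · rw [(htr 0 h0t).metricIn_eq he₁, hJ0, hΦ0', hone]
    simp
  intro m i j
  have hG : ∀ a b, DifferentiableAt ℝ (fun w => metricIn e₁ g w a b) 0 := fun a b =>
    differentiableAt_of_contDiffOn e₁.open_target (hg e₁ he₁ a b) h0t₁
  have hGΦd : ∀ a b, HasFDerivAt (fun w => metricIn e₁ g (quadraticMap c w) a b)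
      ((fderiv ℝ (fun w => metricIn e₁ g w a b) 0).comp (fderiv ℝ (quadraticMap c) 0)) 0 :=
    fun a b => HasFDerivAt.comp (g := fun w => metricIn e₁ g w a b) 0
      (by rw [hΦ0']; exact (hG a b).hasFDerivAt) (hΦ.differentiable (by simp) 0).hasFDerivAt
  have hGΦ : ∀ a b, pderiv m (fun w => metricIn e₁ g (quadraticMap c w) a b) 0 = D m a b := by
    intro a b
    have hs : fderiv ℝ (quadraticMap c) 0 (EuclideanSpace.single m 1) =
        EuclideanSpace.single m 1 := by
      rw [fderiv_single_eq_sum, hJ0]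
      ext b
      simp [Matrix.one_apply]
    simp only [pderiv, (hGΦd a b).fderiv, ContinuousLinearMap.comp_apply, hs, hD]
  have hJd : ∀ a b, DifferentiableAt ℝ (fun w => jacobian (quadraticMap c) w a b) 0 := fun a b => by
    simp only [jacobian_quadraticMap hcs]
    fun_prop
  have hJp : ∀ a b, pderiv m (fun w => jacobian (quadraticMap c) w a b) 0 = -c a b m := by
    intro a b
    simp only [jacobian_quadraticMap hcs]
    rw [pderiv_sub (by fun_prop) (by fun_prop), pderiv_const,
      pderiv_sum fun l _ => (differentiableAt_coord l).const_mul _]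
    simp only [pderiv_const_mul (differentiableAt_coord _), pderiv_coord, Matrix.one_apply,
      mul_ite, mul_one, mul_zero, Finset.sum_ite_eq', Finset.mem_univ, if_true, zero_sub]
  have hmain : EqOn (fun w => metricIn e' g w i j) (fun w => ∑ b, (∑ a,
      jacobian (quadraticMap c) w a i * metricIn e₁ g (quadraticMap c w) a b)
        * jacobian (quadraticMap c) w b j) e'.target := by
    intro w hw
    simp only [(htr w hw).metricIn_eq he₁, Matrix.mul_apply, Matrix.transpose_apply]
  have hJG : ∀ a b, DifferentiableAt ℝ (fun w => jacobian (quadraticMap c) w a i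
      * metricIn e₁ g (quadraticMap c w) a b) 0 := fun a b =>
    (hJd a i).fun_mul (hGΦd a b).differentiableAt
  have hJGs : ∀ b, DifferentiableAt ℝ (fun w => ∑ a, jacobian (quadraticMap c) w a i
      * metricIn e₁ g (quadraticMap c w) a b) 0 := fun b =>
    DifferentiableAt.fun_sum fun a _ => hJG a b
  rw [pderiv_congr e'.open_target hmain h0t, pderiv_sum fun b _ => (hJGs b).fun_mul (hJd b j)]
  have hterm : ∀ b, pderiv m (fun w => (∑ a, jacobian (quadraticMap c) w a i
      * metricIn e₁ g (quadraticMap c w) a b) * jacobian (quadraticMap c) w b j) 0 =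
      (-c b i m + D m i b) * (1 : Matrix (Fin n) (Fin n) ℝ) b j
        + (1 : Matrix (Fin n) (Fin n) ℝ) i b * -c b j m := by
    intro b
    rw [pderiv_mul (hJGs b) (hJd b j), pderiv_sum fun a _ => hJG a b]
    simp only [pderiv_mul (hJd _ i) (hGΦd _ b).differentiableAt, hJp, hGΦ, hJ0, hΦ0', hone,
      Finset.sum_add_distrib, Matrix.one_apply, mul_ite, ite_mul, mul_one, one_mul, mul_zero,
      zero_mul, Finset.sum_ite_eq', Finset.mem_univ, if_true]
    by_cases hib : i = b
    · subst hib; simp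
    · simp [hib, Ne.symm hib]
  simp only [hterm, Finset.sum_add_distrib, Matrix.one_apply, mul_ite, ite_mul, mul_one, one_mul,
    mul_zero, zero_mul, Finset.sum_ite_eq, Finset.sum_ite_eq', Finset.mem_univ, if_true]
  -- What remains is `D m i j = c j i m + c i j m`, metric compatibility at the origin.
  simp only [hc]
  linarith [hDs i m j, hDs j m i, hDs m j i]

end NormalChart

/-! ### Closedness of exact forms, and continuity of spatial derivatives -/

section Closed

variable {n : ℕ} {U : Set (EuclideanSpace ℝ (Fin n))} {z : EuclideanSpace ℝ (Fin n)}

/-- This is `d² = 0` in components: the second partial derivatives cancel in pairs by symmetry. -/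
theorem closed_of_eq_alternation₂ (hU : IsOpen U) {a : Fin n → EuclideanSpace ℝ (Fin n) → ℝ}
    (ha : ∀ i, ContDiffOn ℝ ∞ (a i) U) {S : Fin n → Fin n → EuclideanSpace ℝ (Fin n) → ℝ}
    (hS : ∀ i j, EqOn (S i j) (fun z => pderiv i (a j) z - pderiv j (a i) z) U) (hz : z ∈ U)
    (k i j : Fin n) : pderiv k (S i j) z - pderiv i (S k j) z + pderiv j (S k i) z = 0 := by
  have hd i j := differentiableAt_of_contDiffOn hU (contDiffOn_pderiv hU i (ha j)) hz
  have h : ∀ k i j, pderiv k (S i j) z =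
      pderiv k (pderiv i (a j)) z - pderiv k (pderiv j (a i)) z := fun k i j => by
    rw [pderiv_congr hU (hS i j) hz, pderiv_sub (hd i j) (hd j i)]
  rw [h, h, h, pderiv_comm hU (ha j) hz k i, pderiv_comm hU (ha i) hz k j,
    pderiv_comm hU (ha k) hz i j]
  ring

theorem closed_of_eq_alternation₃ (hU : IsOpen U)
    {b : Fin n → Fin n → EuclideanSpace ℝ (Fin n) → ℝ} (hb : ∀ i j, ContDiffOn ℝ ∞ (b i j) U)
    {S : Fin n → Fin n → Fin n → EuclideanSpace ℝ (Fin n) → ℝ}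
    (hS : ∀ i j k, EqOn (S i j k)
      (fun z => pderiv i (b j k) z - pderiv j (b i k) z + pderiv k (b i j) z) U) (hz : z ∈ U)
    (k i j m : Fin n) : pderiv k (S i j m) z - pderiv i (S k j m) z + pderiv j (S k i m) z
      - pderiv m (S k i j) z = 0 := by
  have hd a i j := differentiableAt_of_contDiffOn hU (contDiffOn_pderiv hU a (hb i j)) hz
  have h : ∀ k i j m, pderiv k (S i j m) z = pderiv k (pderiv i (b j m)) z
      - pderiv k (pderiv j (b i m)) z + pderiv k (pderiv m (b i j)) z := fun k i j m => by
    rw [pderiv_congr hU (hS i j m) hz, pderiv_add ((hd i j m).fun_sub (hd j i m)) (hd m i j),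
      pderiv_sub (hd i j m) (hd j i m)]
  rw [h, h, h, h, pderiv_comm hU (hb j m) hz k i, pderiv_comm hU (hb i m) hz k j,
    pderiv_comm hU (hb i j) hz k m, pderiv_comm hU (hb k m) hz i j, pderiv_comm hU (hb k j) hz i m,
    pderiv_comm hU (hb k i) hz j m]
  ring

/-- The spatial partial derivatives of a time-dependent smooth function are continuous up to the
ends of the time interval. -/
theorem continuousOn_pderiv_slice (hU : IsOpen U) {T : ℝ} (hT : 0 < T)
    {b : EuclideanSpace ℝ (Fin n) × ℝ → ℝ} (hb : ContDiffOn ℝ ∞ b (U ×ˢ Icc 0 T)) (i : Fin n) :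
    ContinuousOn (fun p : EuclideanSpace ℝ (Fin n) × ℝ => pderiv i (fun z => b (z, p.2)) p.1)
      (U ×ˢ Icc 0 T) := by
  -- At the end times only derivatives within the closed slab are available. They are continuous
  -- there, and in spatial directions they agree with ordinary derivatives because `U` is open.
  have hu : UniqueDiffOn ℝ (U ×ˢ Icc (0 : ℝ) T) := hU.uniqueDiffOn.prod (uniqueDiffOn_Icc hT)
  have hc := (hb.continuousOn_fderivWithin hu (by simp)).clm_apply
    (continuousOn_const (c := ((EuclideanSpace.single i 1, 0) : EuclideanSpace ℝ (Fin n) × ℝ)))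
  refine hc.congr fun p hp => ?_
  have h₁ := ((hb p hp).differentiableWithinAt (by simp)).hasFDerivWithinAt
  have h₂ : HasFDerivWithinAt (fun z => (z, p.2))
      (ContinuousLinearMap.inl ℝ (EuclideanSpace ℝ (Fin n)) ℝ) U p.1 :=
    (hasFDerivAt_prodMk_left p.1 p.2).hasFDerivWithinAt
  have hm : MapsTo (fun z => (z, p.2)) U (U ×ˢ Icc 0 T) := fun z hz => ⟨hz, hp.2⟩
  have h₃ := (HasFDerivWithinAt.comp p.1 (g := b) h₁ h₂ hm).hasFDerivAt (hU.mem_nhds hp.1)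
  change fderiv ℝ (b ∘ fun z => (z, p.2)) p.1 _ = _
  rw [h₃.fderiv]
  simp

end Closed

/-! ### Components of forms and of exterior derivatives -/

section Components

variable {n : ℕ} {M : Type*} [TopologicalSpace M] [ChartedSpace (EuclideanSpace ℝ (Fin n)) M]
  {e : OpenPartialHomeomorph M (EuclideanSpace ℝ (Fin n))} {y : EuclideanSpace ℝ (Fin n)}
  {T : ℝ}

theorem comp₂_antisymm (α : Form n M 2) (i j : Fin n) : comp₂ e α i j y = -comp₂ e α j i y := by
  refine Eq.trans ?_ ((formIn e α y).toAlternatingMap.map_swap 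
    ![EuclideanSpace.single j 1, EuclideanSpace.single i 1]
    (show (0 : Fin 2) ≠ 1 by decide))
  refine congrArg (formIn e α y) ?_
  ext a : 1
  fin_cases a <;> rfl

theorem comp₃_antisymm_left (α : Form n M 3) (i j k : Fin n) :
    comp₃ e α i j k y = -comp₃ e α j i k y := by
  refine Eq.trans ?_ ((formIn e α y).toAlternatingMap.map_swap 
    ![EuclideanSpace.single j 1, EuclideanSpace.single i 1, EuclideanSpace.single k 1]
    (show (0 : Fin 3) ≠ 1 by decide))
  refine congrArg (formIn e α y) ?_
  ext a : 1
  fin_cases a <;> rfl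

theorem comp₃_antisymm_right (α : Form n M 3) (i j k : Fin n) :
    comp₃ e α i j k y = -comp₃ e α i k j y := by
  refine Eq.trans ?_ ((formIn e α y).toAlternatingMap.map_swap 
    ![EuclideanSpace.single i 1, EuclideanSpace.single k 1, EuclideanSpace.single j 1]
    (show (1 : Fin 3) ≠ 2 by decide))
  refine congrArg (formIn e α y) ?_
  ext a : 1
  fin_cases a <;> rfl

theorem SmoothFormOn.contDiffOn_apply {p : ℕ} {α : ℝ → Form n M p} (h : SmoothFormOn T α)
    (he : e ∈ IsManifold.maximalAtlas (𝓡 n) ∞ M) (v : Fin p → EuclideanSpace ℝ (Fin n)) :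
    ContDiffOn ℝ ∞ (fun z : EuclideanSpace ℝ (Fin n) × ℝ => formIn e (α z.2) z.1 v)
      (e.target ×ˢ Icc 0 T) :=
  (ContinuousAlternatingMap.apply ℝ (EuclideanSpace ℝ (Fin n)) ℝ v).contDiff.comp_contDiffOn
    (h e he)

theorem SmoothFormOn.contDiffOn_formIn {p : ℕ} {α : ℝ → Form n M p} (h : SmoothFormOn T α)
    (he : e ∈ IsManifold.maximalAtlas (𝓡 n) ∞ M) {t : ℝ} (ht : t ∈ Icc 0 T) :
    ContDiffOn ℝ ∞ (formIn e (α t)) e.target :=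
  (h e he).comp (f := fun z => (z, t)) (contDiffOn_id.prodMk contDiffOn_const)
    fun _ hz => ⟨hz, ht⟩

theorem SmoothFormOn.contDiffOn_slice {p : ℕ} {α : ℝ → Form n M p} (h : SmoothFormOn T α)
    (he : e ∈ IsManifold.maximalAtlas (𝓡 n) ∞ M) {t : ℝ} (ht : t ∈ Icc 0 T)
    (v : Fin p → EuclideanSpace ℝ (Fin n)) :
    ContDiffOn ℝ ∞ (fun z => formIn e (α t) z v) e.target :=
  (ContinuousAlternatingMap.apply ℝ (EuclideanSpace ℝ (Fin n)) ℝ v).contDiff.comp_contDiffOn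
    (h.contDiffOn_formIn he ht)

theorem IsExtDeriv.comp₂_eq {η : Form n M 2} {α : Form n M 1} (h : IsExtDeriv η α)
    (he : e ∈ IsManifold.maximalAtlas (𝓡 n) ∞ M) (hα : ContDiffOn ℝ ∞ (formIn e α) e.target)
    (hy : y ∈ e.target) (i j : Fin n) :
    comp₂ e η i j y = pderiv i (comp₁ e α j) y - pderiv j (comp₁ e α i) y := by
  have hd := (hα.contDiffAt (e.open_target.mem_nhds hy)).differentiableAt (by simp)
  unfold comp₂ comp₁ pderiv
  rw [h e he y hy, extDeriv_apply hd]
  have h₀ : (0 : Fin 2).removeNth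
      ![EuclideanSpace.single i (1 : ℝ), EuclideanSpace.single j (1 : ℝ)] =
      ![EuclideanSpace.single j 1] := by
    ext a : 1; fin_cases a; rfl
  have h₁ : (1 : Fin 2).removeNth
      ![EuclideanSpace.single i (1 : ℝ), EuclideanSpace.single j (1 : ℝ)] =
      ![EuclideanSpace.single i 1] := by
    ext a : 1; fin_cases a; rfl
  rw [Fin.sum_univ_two, h₀, h₁]
  simp [sub_eq_add_neg]

theorem IsExtDeriv.comp₃_eq {η : Form n M 3} {α : Form n M 2} (h : IsExtDeriv η α)
    (he : e ∈ IsManifold.maximalAtlas (𝓡 n) ∞ M) (hα : ContDiffOn ℝ ∞ (formIn e α) e.target)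
    (hy : y ∈ e.target) (i j k : Fin n) :
    comp₃ e η i j k y =
      pderiv i (comp₂ e α j k) y - pderiv j (comp₂ e α i k) y + pderiv k (comp₂ e α i j) y := by
  have hd := (hα.contDiffAt (e.open_target.mem_nhds hy)).differentiableAt (by simp)
  unfold comp₃ comp₂ pderiv
  rw [h e he y hy, extDeriv_apply hd]
  have h₀ : (0 : Fin 3).removeNth ![EuclideanSpace.single i (1 : ℝ),
      EuclideanSpace.single j (1 : ℝ), EuclideanSpace.single k (1 : ℝ)] =
      ![EuclideanSpace.single j 1, EuclideanSpace.single k 1] := by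
    ext a : 1; fin_cases a <;> rfl
  have h₁ : (1 : Fin 3).removeNth ![EuclideanSpace.single i (1 : ℝ),
      EuclideanSpace.single j (1 : ℝ), EuclideanSpace.single k (1 : ℝ)] =
      ![EuclideanSpace.single i 1, EuclideanSpace.single k 1] := by
    ext a : 1; fin_cases a <;> rfl
  have h₂ : (2 : Fin 3).removeNth ![EuclideanSpace.single i (1 : ℝ),
      EuclideanSpace.single j (1 : ℝ), EuclideanSpace.single k (1 : ℝ)] =
      ![EuclideanSpace.single i 1, EuclideanSpace.single j 1] := by
    ext a : 1; fin_cases a <;> rfl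
  rw [Fin.sum_univ_three, h₀, h₁, h₂]
  simp [sub_eq_add_neg]

end Components

/-! ### Evolution of the squared norms along the flow -/

namespace IsSolution

variable {n : ℕ} {M : Type*} [TopologicalSpace M] [ChartedSpace (EuclideanSpace ℝ (Fin n)) M]
  [IsManifold (𝓡 n) ∞ M] {T : ℝ} {g : ℝ → Metric n M} {A : ℝ → Form n M 1} {B : ℝ → Form n M 2}
  {F : ℝ → Form n M 2} {H : ℝ → Form n M 3}
  {e : OpenPartialHomeomorph M (EuclideanSpace ℝ (Fin n))} {y : EuclideanSpace ℝ (Fin n)} {t : ℝ}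

theorem contDiffOn_metricIn (h : IsSolution T g A B F H)
    (he : e ∈ IsManifold.maximalAtlas (𝓡 n) ∞ M) (ht : t ∈ Icc 0 T) (i j : Fin n) :
    ContDiffOn ℝ ∞ (fun z => metricIn e (g t) z i j) e.target :=
  (h.smooth_g e he i j).comp (f := fun z => (z, t)) (contDiffOn_id.prodMk contDiffOn_const)
    fun _ hz => ⟨hz, ht⟩

theorem F_comp_eq (h : IsSolution T g A B F H) (he : e ∈ IsManifold.maximalAtlas (𝓡 n) ∞ M)
    (ht : t ∈ Icc 0 T) (hy : y ∈ e.target) (i j : Fin n) :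
    comp₂ e (F t) i j y = pderiv i (comp₁ e (A t) j) y - pderiv j (comp₁ e (A t) i) y :=
  (h.F_eq t ht).comp₂_eq he (h.smooth_A.contDiffOn_formIn he ht) hy i j

theorem H_comp_eq (h : IsSolution T g A B F H) (he : e ∈ IsManifold.maximalAtlas (𝓡 n) ∞ M)
    (ht : t ∈ Icc 0 T) (hy : y ∈ e.target) (i j k : Fin n) :
    comp₃ e (H t) i j k y = pderiv i (comp₂ e (B t) j k) y - pderiv j (comp₂ e (B t) i k) y
      + pderiv k (comp₂ e (B t) i j) y :=
  (h.H_eq t ht).comp₃_eq he (h.smooth_B.contDiffOn_formIn he ht) hy i j k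

/-- Smoothness is assumed only for the potentials; regularity of the field strengths is read off
from their component formulas as exterior derivatives. -/
theorem contDiffOn_F (h : IsSolution T g A B F H) (he : e ∈ IsManifold.maximalAtlas (𝓡 n) ∞ M)
    (ht : t ∈ Icc 0 T) (i j : Fin n) : ContDiffOn ℝ ∞ (comp₂ e (F t) i j) e.target := by
  have hA i : ContDiffOn ℝ ∞ (comp₁ e (A t) i) e.target := h.smooth_A.contDiffOn_slice he ht _
  exact ((contDiffOn_pderiv e.open_target i (hA j)).sub
    (contDiffOn_pderiv e.open_target j (hA i))).congr fun z hz => h.F_comp_eq he ht hz i j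

theorem contDiffOn_H (h : IsSolution T g A B F H) (he : e ∈ IsManifold.maximalAtlas (𝓡 n) ∞ M)
    (ht : t ∈ Icc 0 T) (i j k : Fin n) : ContDiffOn ℝ ∞ (comp₃ e (H t) i j k) e.target := by
  have hB i j : ContDiffOn ℝ ∞ (comp₂ e (B t) i j) e.target := h.smooth_B.contDiffOn_slice he ht _
  exact (((contDiffOn_pderiv e.open_target i (hB j k)).sub
    (contDiffOn_pderiv e.open_target j (hB i k))).add
    (contDiffOn_pderiv e.open_target k (hB i j))).congr fun z hz => h.H_comp_eq he ht hz i j k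

theorem continuousOn_F (h : IsSolution T g A B F H) (hT : 0 < T)
    (he : e ∈ IsManifold.maximalAtlas (𝓡 n) ∞ M) (i j : Fin n) :
    ContinuousOn (fun p : EuclideanSpace ℝ (Fin n) × ℝ => comp₂ e (F p.2) i j p.1)
      (e.target ×ˢ Icc 0 T) := by
  have hA i a := continuousOn_pderiv_slice e.open_target hT
    (h.smooth_A.contDiffOn_apply he ![EuclideanSpace.single a 1]) i
  exact ((hA i j).sub (hA j i)).congr fun p hp => h.F_comp_eq he hp.2 hp.1 i j

theorem continuousOn_H (h : IsSolution T g A B F H) (hT : 0 < T)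
    (he : e ∈ IsManifold.maximalAtlas (𝓡 n) ∞ M) (i j k : Fin n) :
    ContinuousOn (fun p : EuclideanSpace ℝ (Fin n) × ℝ => comp₃ e (H p.2) i j k p.1)
      (e.target ×ˢ Icc 0 T) := by
  have hB i a b := continuousOn_pderiv_slice e.open_target hT
    (h.smooth_B.contDiffOn_apply he ![EuclideanSpace.single a 1, EuclideanSpace.single b 1]) i
  exact (((hB i j k).sub (hB j i k)).add (hB k i j)).congr
    fun p hp => h.H_comp_eq he hp.2 hp.1 i j k

theorem continuousOn_inv (h : IsSolution T g A B F H)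
    (he : e ∈ IsManifold.maximalAtlas (𝓡 n) ∞ M) (i j : Fin n) :
    ContinuousOn (fun p : EuclideanSpace ℝ (Fin n) × ℝ => (metricIn e (g p.2) p.1)⁻¹ i j)
      (e.target ×ˢ Icc 0 T) :=
  (contDiffOn_inv_apply (G := fun p : EuclideanSpace ℝ (Fin n) × ℝ => metricIn e (g p.2) p.1)
    (h.smooth_g e he) (fun p hp => det_metricIn_ne_zero he (g p.2) hp.1) i j).continuousOn

/-- The squared norm `|F|²` as a function on `M × [0, T]`. -/
def sqNormF (g : ℝ → Metric n M) (F : ℝ → Form n M 2) (x : M) (t : ℝ) : ℝ :=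
  normSq₂ (metricIn (chartAt (EuclideanSpace ℝ (Fin n)) x) (g t) (chartAt _ x x))⁻¹
    fun i j => comp₂ (chartAt _ x) (F t) i j (chartAt _ x x)

/-- The squared norm `|H|²` as a function on `M × [0, T]`. -/
def sqNormH (g : ℝ → Metric n M) (H : ℝ → Form n M 3) (x : M) (t : ℝ) : ℝ :=
  normSq₃ (metricIn (chartAt (EuclideanSpace ℝ (Fin n)) x) (g t) (chartAt _ x x))⁻¹
    fun i j k => comp₃ (chartAt _ x) (H t) i j k (chartAt _ x x)

/-- The definition uses a chart that changes with `x`. Chart independence lets one fixed chart serve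
a whole neighbourhood and all times, as continuity and differentiation require. -/
theorem sqNormF_eq (he : e ∈ IsManifold.maximalAtlas (𝓡 n) ∞ M) {x : M} (hx : x ∈ e.source)
    (t : ℝ) : sqNormF g F x t =
      normSq₂ (metricIn e (g t) (e x))⁻¹ fun i j => comp₂ e (F t) i j (e x) :=
  normSq₂_chart_eq he (IsManifold.chart_mem_maximalAtlas x) hx (mem_chart_source _ x) (g t) (F t)

theorem sqNormH_eq (he : e ∈ IsManifold.maximalAtlas (𝓡 n) ∞ M) {x : M} (hx : x ∈ e.source)
    (t : ℝ) : sqNormH g H x t =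
      normSq₃ (metricIn e (g t) (e x))⁻¹ fun i j k => comp₃ e (H t) i j k (e x) :=
  normSq₃_chart_eq he (IsManifold.chart_mem_maximalAtlas x) hx (mem_chart_source _ x) (g t) (H t)

/-- Joint continuity is local, so it can be tested in the preferred chart of each point, whose
source is a neighbourhood. -/
theorem continuousOn_of_charts {u : M → ℝ → ℝ}
    {w : OpenPartialHomeomorph M (EuclideanSpace ℝ (Fin n)) → EuclideanSpace ℝ (Fin n) × ℝ → ℝ}
    (hw : ∀ e ∈ IsManifold.maximalAtlas (𝓡 n) ∞ M, ContinuousOn (w e) (e.target ×ˢ Icc 0 T))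
    (hu : ∀ e ∈ IsManifold.maximalAtlas (𝓡 n) ∞ M, ∀ x ∈ e.source, ∀ t, u x t = w e (e x, t)) :
    ContinuousOn (fun p : M × ℝ => u p.1 p.2) (univ ×ˢ Icc 0 T) := by
  rintro ⟨x, t⟩ ⟨-, ht⟩
  set e := chartAt (EuclideanSpace ℝ (Fin n)) x with he
  have hem : e ∈ IsManifold.maximalAtlas (𝓡 n) ∞ M := IsManifold.chart_mem_maximalAtlas x
  have hx : x ∈ e.source := mem_chart_source _ x
  have hc : ContinuousOn (fun p : M × ℝ => w e (e p.1, p.2)) (e.source ×ˢ Icc 0 T) :=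
    (hw e hem).comp (f := fun p : M × ℝ => (e p.1, p.2))
      ((e.continuousOn.comp continuousOn_fst fun p hp => hp.1).prodMk continuousOn_snd)
      fun p hp => ⟨e.map_source hp.1, hp.2⟩
  have hc' : ContinuousOn (fun p : M × ℝ => u p.1 p.2) (e.source ×ˢ Icc 0 T) :=
    hc.congr fun p hp => hu e hem p.1 hp.1 p.2
  refine (hc' (x, t) ⟨hx, ht⟩).mono_of_mem_nhdsWithin ?_
  have h₁ : e.source ×ˢ (univ : Set ℝ) ∈ 𝓝 (x, t) :=
    prod_mem_nhds (e.open_source.mem_nhds hx) univ_mem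
  refine mem_of_superset (inter_mem (mem_nhdsWithin_of_mem_nhds h₁) self_mem_nhdsWithin) ?_
  rintro p ⟨hp₁, hp₂⟩
  exact ⟨hp₁.1, hp₂.2⟩

theorem continuousOn_sqNormF (h : IsSolution T g A B F H) (hT : 0 < T) :
    ContinuousOn (fun p : M × ℝ => sqNormF g F p.1 p.2) (univ ×ˢ Icc 0 T) := by
  refine continuousOn_of_charts (w := fun e p =>
    normSq₂ (metricIn e (g p.2) p.1)⁻¹ fun i j => comp₂ e (F p.2) i j p.1) (fun e he => ?_)
    fun e he x hx t => sqNormF_eq he hx t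
  exact continuousOn_finsetSum _ fun i _ => continuousOn_finsetSum _ fun j _ =>
    continuousOn_finsetSum _ fun a _ => continuousOn_finsetSum _ fun b _ =>
      (((h.continuousOn_inv he i a).mul (h.continuousOn_inv he j b)).mul
        (h.continuousOn_F hT he i j)).mul (h.continuousOn_F hT he a b)

theorem continuousOn_sqNormH (h : IsSolution T g A B F H) (hT : 0 < T) :
    ContinuousOn (fun p : M × ℝ => sqNormH g H p.1 p.2) (univ ×ˢ Icc 0 T) := by
  refine continuousOn_of_charts (w := fun e p =>
    normSq₃ (metricIn e (g p.2) p.1)⁻¹ fun i j k => comp₃ e (H p.2) i j k p.1) (fun e he => ?_)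
    fun e he x hx t => sqNormH_eq he hx t
  exact continuousOn_finsetSum _ fun i _ => continuousOn_finsetSum _ fun j _ =>
    continuousOn_finsetSum _ fun k _ => continuousOn_finsetSum _ fun a _ =>
    continuousOn_finsetSum _ fun b _ => continuousOn_finsetSum _ fun c _ =>
      ((((h.continuousOn_inv he i a).mul (h.continuousOn_inv he j b)).mul
        (h.continuousOn_inv he k c)).mul (h.continuousOn_H hT he i j k)).mul
        (h.continuousOn_H hT he a b c)

/-- Joint smoothness of the potential lets the spatial derivative pass through the flow equation,
which holds throughout a neighbourhood of `y`. Interior times make the one-sided time derivatives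
two-sided. -/
theorem hasDerivAt_comp₁ (h : IsSolution T g A B F H) (he : e ∈ IsManifold.maximalAtlas (𝓡 n) ∞ M)
    (ht : t ∈ Ioo 0 T) (hy : y ∈ e.target) (m i : Fin n) :
    HasDerivAt (fun s => pderiv m (comp₁ e (A s) i) y)
      (pderiv m (fun z => -∑ k, ∑ l, (metricIn e (g t) z)⁻¹ k l *
        covDeriv₂ (metricIn e (g t)) (comp₂ e (F t)) k i l z) y) t := by
  refine hasDerivAt_pderiv
    (b := fun p : EuclideanSpace ℝ (Fin n) × ℝ => comp₁ e (A p.2) i p.1)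
    ((h.smooth_A.contDiffOn_apply he _).contDiffAt
      (prod_mem_nhds (e.open_target.mem_nhds hy) (Icc_mem_nhds ht.1 ht.2))) ?_ m
  filter_upwards [e.open_target.mem_nhds hy] with z hz
  exact (h.flow_A e he z hz t (Ioo_subset_Icc_self ht) i).hasDerivAt (Icc_mem_nhds ht.1 ht.2)

theorem hasDerivAt_comp₂ (h : IsSolution T g A B F H) (he : e ∈ IsManifold.maximalAtlas (𝓡 n) ∞ M)
    (ht : t ∈ Ioo 0 T) (hy : y ∈ e.target) (m i j : Fin n) :
    HasDerivAt (fun s => pderiv m (comp₂ e (B s) i j) y)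
      (pderiv m (fun z => ∑ k, ∑ l, (metricIn e (g t) z)⁻¹ k l *
        covDeriv₃ (metricIn e (g t)) (comp₃ e (H t)) k l i j z) y) t := by
  refine hasDerivAt_pderiv
    (b := fun p : EuclideanSpace ℝ (Fin n) × ℝ => comp₂ e (B p.2) i j p.1)
    ((h.smooth_B.contDiffOn_apply he _).contDiffAt
      (prod_mem_nhds (e.open_target.mem_nhds hy) (Icc_mem_nhds ht.1 ht.2))) ?_ m
  filter_upwards [e.open_target.mem_nhds hy] with z hz
  exact (h.flow_B e he z hz t (Ioo_subset_Icc_self ht) i j).hasDerivAt (Icc_mem_nhds ht.1 ht.2)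

/-- The time derivative commutes with `d`, so `∂_t F = d(∂_t A)`. -/
theorem hasDerivAt_F (h : IsSolution T g A B F H) (he : e ∈ IsManifold.maximalAtlas (𝓡 n) ∞ M)
    (ht : t ∈ Ioo 0 T) (hy : y ∈ e.target) {τ : Fin n → Fin n → ℝ}
    (hτ : ∀ i j, τ i j = pderiv i (fun z => -∑ k, ∑ l, (metricIn e (g t) z)⁻¹ k l *
      covDeriv₂ (metricIn e (g t)) (comp₂ e (F t)) k j l z) y) (i j : Fin n) :
    HasDerivAt (fun s => comp₂ e (F s) i j y) (τ i j - τ j i) t := by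
  rw [hτ, hτ]
  refine ((h.hasDerivAt_comp₁ he ht hy i j).sub
    (h.hasDerivAt_comp₁ he ht hy j i)).congr_of_eventuallyEq ?_
  filter_upwards [Icc_mem_nhds ht.1 ht.2] with s hs using h.F_comp_eq he hs hy i j

theorem hasDerivAt_H (h : IsSolution T g A B F H) (he : e ∈ IsManifold.maximalAtlas (𝓡 n) ∞ M)
    (ht : t ∈ Ioo 0 T) (hy : y ∈ e.target) {τ : Fin n → Fin n → Fin n → ℝ}
    (hτ : ∀ i j k, τ i j k = pderiv i (fun z => ∑ a, ∑ b, (metricIn e (g t) z)⁻¹ a b *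
      covDeriv₃ (metricIn e (g t)) (comp₃ e (H t)) a b j k z) y) (i j k : Fin n) :
    HasDerivAt (fun s => comp₃ e (H s) i j k y) (τ i j k - τ j i k + τ k i j) t := by
  rw [hτ, hτ, hτ]
  refine (((h.hasDerivAt_comp₂ he ht hy i j k).sub (h.hasDerivAt_comp₂ he ht hy j i k)).add
    (h.hasDerivAt_comp₂ he ht hy k i j)).congr_of_eventuallyEq ?_
  filter_upwards [Icc_mem_nhds ht.1 ht.2] with s hs using h.H_comp_eq he hs hy i j k

/-- The chart stays fixed while `s` varies, and the metric need be the identity only at time `t`.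
The terms are grouped as Ricci part plus reaction part, which are treated differently. -/
theorem hasDerivAt_inv (h : IsSolution T g A B F H) (he : e ∈ IsManifold.maximalAtlas (𝓡 n) ∞ M)
    (ht : t ∈ Ioo 0 T) (hy : y ∈ e.target) (h1 : metricIn e (g t) y = 1) (i j : Fin n) :
    HasDerivAt (fun s => (metricIn e (g s) y)⁻¹ i j)
      (-(-2 * ricci (metricIn e (g t)) i j y + ((1 / 2) * hTensor (g t) e (H t) i j y
          + 2 * fTensor (g t) e (F t) i j y))) t :=
  hasDerivAt_inv_apply_of_eq_one (G := fun s => metricIn e (g s) y)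
    (G' := fun i j => -2 * ricci (metricIn e (g t)) i j y + ((1 / 2) * hTensor (g t) e (H t) i j y
      + 2 * fTensor (g t) e (F t) i j y))
    (fun i j => by
      rw [← add_assoc]
      exact (h.flow_g e he y hy t (Ioo_subset_Icc_self ht) i j).hasDerivAt
        (Icc_mem_nhds ht.1 ht.2)) h1 i j

theorem hTensor_eq (h1 : metricIn e (g t) y = 1) (i j : Fin n) :
    hTensor (g t) e (H t) i j y =
      ∑ a : Fin n × Fin n, comp₃ e (H t) i a.1 a.2 y * comp₃ e (H t) j a.1 a.2 y := by
  simp [hTensor, h1, Matrix.one_apply, Fintype.sum_prod_type]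

theorem fTensor_eq (h1 : metricIn e (g t) y = 1) (i j : Fin n) :
    fTensor (g t) e (F t) i j y = ∑ k, comp₂ e (F t) i k y * comp₂ e (F t) j k y := by
  simp [fTensor, h1, Matrix.one_apply]

/-- Where the metric is the identity, `h` and `f` are Gram matrices of the components of `H` and
`F`. The general index type `β` covers pairing with either form. -/
theorem sum_reaction_nonneg (h1 : metricIn e (g t) y = 1) {β : Type*} [Fintype β]
    (w : Fin n → β → ℝ) :
    0 ≤ ∑ i, ∑ j, ((1 / 2) * hTensor (g t) e (H t) i j y + 2 * fTensor (g t) e (F t) i j y)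
      * ∑ b, w i b * w j b := by
  have h₁ := sum_sum_mul_sum_sum_nonneg
    (fun i (a : Fin n × Fin n) => comp₃ e (H t) i a.1 a.2 y) w
  have h₂ := sum_sum_mul_sum_sum_nonneg (fun i a => comp₂ e (F t) i a y) w
  simp only [hTensor_eq h1, fTensor_eq h1, add_mul, Finset.sum_add_distrib, mul_assoc,
    ← Finset.mul_sum]
  positivity

theorem exists_deriv_le_sqNormF (h : IsSolution T g A B F H) {K : ℝ}
    (hK : ∀ t ∈ Icc 0 T, ∀ e ∈ IsManifold.maximalAtlas (𝓡 n) ∞ M, ∀ x ∈ e.source,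
      rmNorm (g t) e x ≤ K) (x₀ : M) (ht : t ∈ Ioo 0 T)
    (hmax : ∀ x, sqNormF g F x t ≤ sqNormF g F x₀ t) :
    ∃ d, HasDerivAt (sqNormF g F x₀) d t ∧ d ≤ 6 * K * sqNormF g F x₀ t := by
  have htc := Ioo_subset_Icc_self ht
  obtain ⟨e, he, hx, hG⟩ := exists_isNormalAt
    (IsManifold.chart_mem_maximalAtlas (I := 𝓡 n) (n := ∞) x₀) (mem_chart_source _ x₀) (g t)
    fun e he i j => h.contDiffOn_metricIn he htc i j
  set y := e x₀ with hy
  -- Naming `τ` through a definitional identity makes the derivative formula and the inequality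
  -- refer to the same function.
  have hτ : ∀ i j, (fun i j => pderiv i (fun z => -∑ k, ∑ l, (metricIn e (g t) z)⁻¹ k l *
      covDeriv₂ (metricIn e (g t)) (comp₂ e (F t)) k j l z) y) i j = _ := fun _ _ => rfl
  have hder := hasDerivAt_normSq₂ (P := fun s => (metricIn e (g s) y)⁻¹) hG.inv_eq_one
    (h.hasDerivAt_inv he ht hG.mem hG.eq_one) (h.hasDerivAt_F he ht hG.mem hτ)
    (fun i j => comp₂_antisymm (F t) i j)
  have heq : sqNormF g F x₀ = fun s => normSq₂ (metricIn e (g s) y)⁻¹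
      fun i j => comp₂ e (F s) i j y := funext fun s => sqNormF_eq he hx s
  rw [heq]
  refine ⟨_, hder, ?_⟩
  have hlm : IsLocalMax (fun z => normSq₂ (metricIn e (g t) z)⁻¹
      fun i j => comp₂ e (F t) i j z) y := by
    filter_upwards [e.open_target.mem_nhds hG.mem] with z hz
    have h₁ := hmax (e.symm z)
    rwa [sqNormF_eq he (e.map_target hz), sqNormF_eq he hx, e.right_inv hz] at h₁
  have key := hG.evolution_le_of_isLocalMax₂ (h.contDiffOn_F he htc)
    (fun z _ i j => comp₂_antisymm (F t) i j)
    (fun z hz => closed_of_eq_alternation₂ e.open_target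
      (fun i => h.smooth_A.contDiffOn_slice he htc _) (fun i j z hz => h.F_comp_eq he htc hz i j) hz)
    (hK t htc e he x₀ hx) hlm hτ
    (sum_reaction_nonneg (H := H) (F := F) hG.eq_one _)
  simp only [neg_mul _ (∑ k, _), Finset.sum_neg_distrib] at key ⊢
  linarith

theorem exists_deriv_le_sqNormH (h : IsSolution T g A B F H) {K : ℝ}
    (hK : ∀ t ∈ Icc 0 T, ∀ e ∈ IsManifold.maximalAtlas (𝓡 n) ∞ M, ∀ x ∈ e.source,
      rmNorm (g t) e x ≤ K) (x₀ : M) (ht : t ∈ Ioo 0 T)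
    (hmax : ∀ x, sqNormH g H x t ≤ sqNormH g H x₀ t) :
    ∃ d, HasDerivAt (sqNormH g H x₀) d t ∧ d ≤ 6 * K * sqNormH g H x₀ t := by
  have htc := Ioo_subset_Icc_self ht
  obtain ⟨e, he, hx, hG⟩ := exists_isNormalAt
    (IsManifold.chart_mem_maximalAtlas (I := 𝓡 n) (n := ∞) x₀) (mem_chart_source _ x₀) (g t)
    fun e he i j => h.contDiffOn_metricIn he htc i j
  set y := e x₀ with hy
  have hτ : ∀ i j m, (fun i j m => pderiv i (fun z => ∑ k, ∑ l, (metricIn e (g t) z)⁻¹ k l *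
      covDeriv₃ (metricIn e (g t)) (comp₃ e (H t)) k l j m z) y) i j m = _ := fun _ _ _ => rfl
  have hder := hasDerivAt_normSq₃ (P := fun s => (metricIn e (g s) y)⁻¹) hG.inv_eq_one
    (h.hasDerivAt_inv he ht hG.mem hG.eq_one) (h.hasDerivAt_H he ht hG.mem hτ)
    (fun i j k => comp₃_antisymm_left (H t) i j k) (fun i j k => comp₃_antisymm_right (H t) i j k)
  have heq : sqNormH g H x₀ = fun s => normSq₃ (metricIn e (g s) y)⁻¹
      fun i j k => comp₃ e (H s) i j k y := funext fun s => sqNormH_eq he hx s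
  rw [heq]
  refine ⟨_, hder, ?_⟩
  have hlm : IsLocalMax (fun z => normSq₃ (metricIn e (g t) z)⁻¹
      fun i j k => comp₃ e (H t) i j k z) y := by
    filter_upwards [e.open_target.mem_nhds hG.mem] with z hz
    have h₁ := hmax (e.symm z)
    rwa [sqNormH_eq he (e.map_target hz), sqNormH_eq he hx, e.right_inv hz] at h₁
  have hr := sum_reaction_nonneg (H := H) (F := F) hG.eq_one
    fun i (a : Fin n × Fin n) => comp₃ e (H t) i a.1 a.2 y
  simp only [Fintype.sum_prod_type] at hr
  have key := hG.evolution_le_of_isLocalMax₃ (h.contDiffOn_H he htc)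
    (fun z _ i j k => comp₃_antisymm_left (H t) i j k)
    (fun z _ i j k => comp₃_antisymm_right (H t) i j k)
    (fun z hz => closed_of_eq_alternation₃ e.open_target
      (fun i j => h.smooth_B.contDiffOn_slice he htc _)
      (fun i j k z hz => h.H_comp_eq he htc hz i j k) hz)
    (hK t htc e he x₀ hx) hlm hτ hr
  simp only [neg_mul _ (∑ k, _), Finset.sum_neg_distrib] at key ⊢
  linarith

end IsSolution

/-! ### From squared norms to norms, and the conclusion -/

theorem sqrt_le_mul_exp {u K c t : ℝ} (hK : 0 ≤ K) (h : u ≤ K ^ 2 * Real.exp (2 * c * t)) :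
    √u ≤ K * Real.exp (c * t) := by
  rw [Real.sqrt_le_left (by positivity), mul_pow, ← Real.exp_nat_mul]
  convert h using 3
  push_cast
  ring

end GRF

end

theorem theorem6p4 (n : ℕ) :
    ∃ C : ℝ, 0 < C ∧
      ∀ (M : Type*) [TopologicalSpace M] [T2Space M] [CompactSpace M]
        [ChartedSpace (EuclideanSpace ℝ (Fin n)) M] [IsManifold (𝓡 n) ∞ M]
        (T : ℝ) (g : ℝ → GRF.Metric n M) (A : ℝ → GRF.Form n M 1) (B : ℝ → GRF.Form n M 2)
        (F : ℝ → GRF.Form n M 2) (H : ℝ → GRF.Form n M 3) (K₁ K₂ K₃ : ℝ),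
        0 < T → GRF.IsSolution T g A B F H → 0 ≤ K₁ → 0 ≤ K₂ → 0 ≤ K₃ →
        (∀ t ∈ Set.Icc 0 T, ∀ e ∈ IsManifold.maximalAtlas (𝓡 n) ∞ M, ∀ x ∈ e.source,
          GRF.rmNorm (g t) e x ≤ K₁) →
        (∀ e ∈ IsManifold.maximalAtlas (𝓡 n) ∞ M, ∀ x ∈ e.source,
          GRF.norm₃ (g 0) e (H 0) x ≤ K₂) →
        (∀ e ∈ IsManifold.maximalAtlas (𝓡 n) ∞ M, ∀ x ∈ e.source,
          GRF.norm₂ (g 0) e (F 0) x ≤ K₃) →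
        ∀ t ∈ Set.Icc 0 T, ∀ e ∈ IsManifold.maximalAtlas (𝓡 n) ∞ M, ∀ x ∈ e.source,
          GRF.norm₃ (g t) e (H t) x ≤ K₂ * Real.exp (C * K₁ * t) ∧
          GRF.norm₂ (g t) e (F t) x ≤ K₃ * Real.exp (C * K₁ * t) := by
  -- Half of the rate 6 for the squared norms; it does not depend on `n`.
  refine ⟨3, by norm_num, ?_⟩
  intro M _ _ _ _ _ T g A B F H K₁ K₂ K₃ hT h hK₁ hK₂ hK₃ hRm hH₀ hF₀ t ht e he x hx
  have h0 x : x ∈ (chartAt (EuclideanSpace ℝ (Fin n)) x : OpenPartialHomeomorph M _).source :=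
    mem_chart_source _ x
  have hmem (x : M) : chartAt (EuclideanSpace ℝ (Fin n)) x ∈ IsManifold.maximalAtlas (𝓡 n) ∞ M :=
    IsManifold.chart_mem_maximalAtlas x
  constructor
  · refine GRF.sqrt_le_mul_exp hK₂ ?_
    rw [← GRF.IsSolution.sqNormH_eq (g := g) (H := H) he hx t, ← mul_assoc,
      show (2 * 3 : ℝ) = 6 by norm_num]
    exact GRF.le_exp_mul_of_deriv_le_at_max hT (h.continuousOn_sqNormH hT)
      (fun x₀ t₀ ht₀ hm => h.exists_deriv_le_sqNormH hRm x₀ ht₀ hm)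
      (fun x => (Real.sqrt_le_left hK₂).1 (hH₀ _ (hmem x) x (h0 x))) ht x
  · refine GRF.sqrt_le_mul_exp hK₃ ?_
    rw [← GRF.IsSolution.sqNormF_eq (g := g) (F := F) he hx t, ← mul_assoc,
      show (2 * 3 : ℝ) = 6 by norm_num]
    exact GRF.le_exp_mul_of_deriv_le_at_max hT (h.continuousOn_sqNormF hT)
      (fun x₀ t₀ ht₀ hm => h.exists_deriv_le_sqNormF hRm x₀ ht₀ hm)
      (fun x => (Real.sqrt_le_left hK₃).1 (hF₀ _ (hmem x) x (h0 x))) ht x
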